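/- Let $n\ge 2$ and let $\mathbb S^n\subset\mathbb R^{n+1}$ be the round unit sphere with Laplace–Beltrami operator $\Delta$ and surface measure $dw$ normalized so that $\int_{\mathbb S^n}dw=1$. Let $$P_n=\begin{cases}\prod_{k=0}^{\frac{n-2}{2}}\bigl(-\Delta+k(n-k-1)\bigr), & n \text{ even},\\[2pt] \Bigl(-\Delta+\bigl(\tfrac{n-1}{2}\bigr)^2\Bigr)^{1/2}\prod_{k=0}^{\frac{n-3}{2}}\bigl(-\Delta+k(n-k-1)\bigr), & n\text{ odd},\end{cases}$$ be the Paneitz operator on $\mathbb S^n$ (a function of $-\Delta$ in the sense of the spectral theorem), and let $\alpha=\frac1{n+1}$. Suppose that $u\in H^{n/2}(\mathbb S^n)$ is a (weak) solution of $$\alpha P_n u+(n-1)!\left(1-\frac{e^{nu}}{\int_{\mathbb S^n}e^{nu}\,dw}\right)=0\quad\text{on }\mathbb S^n ,$$ that is, $e^{nu}$ is integrable, $P_nu$, taken in the weak sense (by testing against the eigenfunctions of $-\Delta$), is an integrable function, and the equation holds almost everywhere. If $u$ is axially symmetric, i.e. $u(\xi)$ depends only on the first coordinate $\xi_1$ of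 $\xi\in\mathbb S^n$, then $u$ is constant (almost everywhere). -/

import Mathlib

open MeasureTheory Set
open scoped Manifold ContDiff EuclideanSpace

namespace PaneitzSphere

noncomputable section

/-- The unit sphere `𝕊ⁿ` in `ℝⁿ⁺¹`. -/
abbrev Sph (n : ℕ) : Type := Metric.sphere (0 : EuclideanSpace ℝ (Fin (n + 1))) 1

/-- The surface measure on `𝕊ⁿ`, normalized to total mass one. -/
def sphMeasure (n : ℕ) : Measure (Sph n) :=
  ((volume : Measure (EuclideanSpace ℝ (Fin (n + 1)))).toSphere univ)⁻¹ •
    (volume : Measure (EuclideanSpace ℝ (Fin (n + 1)))).toSphere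

instance isProbabilityMeasure_sphMeasure (n : ℕ) : IsProbabilityMeasure (sphMeasure n) := by
  refine ⟨?_⟩
  rw [sphMeasure, Measure.smul_apply, smul_eq_mul]
  refine ENNReal.inv_mul_cancel ?_ (measure_ne_top _ _)
  rw [Ne, Measure.measure_univ_eq_zero]
  exact Measure.toSphere_ne_zero _

open Classical in
/-- The extension of `φ : 𝕊ⁿ → ℝ` to `ℝⁿ⁺¹ ∖ {0}` that is constant along rays,
`x ↦ φ (x / |x|)` (with value `0` at the origin). -/
def radialExt {n : ℕ} (φ : Sph n → ℝ) (x : EuclideanSpace ℝ (Fin (n + 1))) : ℝ :=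
  if hx : x = 0 then 0
  else φ ⟨‖x‖⁻¹ • x, by
    rw [mem_sphere_zero_iff_norm, norm_smul, norm_inv, norm_norm,
      inv_mul_cancel₀ (norm_ne_zero_iff.mpr hx)]⟩

/-- The Laplace–Beltrami operator of the round sphere on smooth functions: the Euclidean
Laplacian, at the points of the sphere, of the extension that is constant along rays. -/
def sphLaplacian {n : ℕ} (φ : Sph n → ℝ) (ξ : Sph n) : ℝ :=
  Laplacian.laplacian (radialExt φ) (ξ : EuclideanSpace ℝ (Fin (n + 1)))

/-- `φ` is a smooth function on `𝕊ⁿ` with `-Δ φ = μ φ`. -/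
def IsEigenfunction {n : ℕ} (μ : ℝ) (φ : Sph n → ℝ) : Prop :=
  ContMDiff (𝓡 n) 𝓘(ℝ, ℝ) ∞ φ ∧ ∀ ξ, -sphLaplacian φ ξ = μ * φ ξ

/-- `v = F(-Δ) u` in the sense of the spectral theorem for `-Δ` on `𝕊ⁿ`: tested against any
eigenfunction of `-Δ` with eigenvalue `μ`, the function `v` is `F μ` times `u`.
(The linear span of the eigenfunctions is dense in the smooth functions.) -/
def IsFunLaplacian {n : ℕ} (F : ℝ → ℝ) (u v : Sph n → ℝ) : Prop :=
  ∀ (μ : ℝ) (φ : Sph n → ℝ), IsEigenfunction μ φ →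
    ∫ ξ, v ξ * φ ξ ∂(sphMeasure n) = F μ * ∫ ξ, u ξ * φ ξ ∂(sphMeasure n)

/-- The Sobolev space `H^s(𝕊ⁿ)`: the domain of `(1 - Δ)^{s/2}` in `L²(𝕊ⁿ)`. -/
def MemSobolev {n : ℕ} (s : ℝ) (u : Sph n → ℝ) : Prop :=
  MemLp u 2 (sphMeasure n) ∧ ∃ v : Sph n → ℝ, MemLp v 2 (sphMeasure n) ∧
    IsFunLaplacian (fun μ => (1 + μ) ^ (s / 2)) u v

/-- The function `F` with `P_n = F(-Δ)`. -/
def paneitzSymbol (n : ℕ) (μ : ℝ) : ℝ :=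
  if Even n then
    ∏ k ∈ Finset.range (n / 2), (μ + (k : ℝ) * ((n : ℝ) - k - 1))
  else
    Real.sqrt (μ + (((n : ℝ) - 1) / 2) ^ 2) *
      ∏ k ∈ Finset.range ((n - 1) / 2), (μ + (k : ℝ) * ((n : ℝ) - k - 1))

/-- `P_n u = v` for the Paneitz operator `P_n` on `𝕊ⁿ`. -/
def IsPaneitz {n : ℕ} (u v : Sph n → ℝ) : Prop :=
  IsFunLaplacian (paneitzSymbol n) u v

/-- `u ∈ H^{n/2}(𝕊ⁿ)` solves `α P_n u + (n-1)! (1 - e^{nu} / ∫ e^{nu}) = 0` on `𝕊ⁿ`,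
where `P_n u` is understood in the weak sense. -/
def IsSolution (n : ℕ) (α : ℝ) (u : Sph n → ℝ) : Prop :=
  MemSobolev ((n : ℝ) / 2) u ∧
  Integrable (fun ξ => Real.exp (n * u ξ)) (sphMeasure n) ∧
  ∃ v : Sph n → ℝ, Integrable v (sphMeasure n) ∧ IsPaneitz u v ∧
    ∀ᵐ ξ ∂(sphMeasure n),
      α * v ξ + ((n - 1).factorial : ℝ) *
        (1 - Real.exp (n * u ξ) / ∫ η, Real.exp (n * u η) ∂(sphMeasure n)) = 0

/-- `u` depends only on the first coordinate (almost everywhere). -/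
def IsAxiallySymmetric {n : ℕ} (u : Sph n → ℝ) : Prop :=
  ∃ g : ℝ → ℝ, Measurable g ∧
    ∀ᵐ ξ ∂(sphMeasure n), u ξ = g ((ξ : EuclideanSpace ℝ (Fin (n + 1))) 0)

end

end PaneitzSphere

/-!
An axially symmetric function on the sphere is a function of the first coordinate `x ∈ (-1, 1)`,
whose law is the probability measure `zonalMeasure n` with density proportional to
`(1 - x²)^(n/2 - 1)` (`map_coord_sphMeasure`). The zonal polynomials `R_k`, normalized by
`R_k(1) = 1`, are eigenfunctions of `-Δ` with eigenvalue `k (k + n - 1)`, on which the Paneitz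
operator has the eigenvalue `p_k = k (k + 1) ⋯ (k + n - 1)`. Testing the equation against them says
that `v = P u = (n + 1) (n - 1)! (e^{nu} / ∫ e^{nu} - 1)` has coefficients `v_k = p_k u_k`.

Pair `v` with the derivative `x (1 - x²) u'` of `u` along half the gradient of `x²`.

* Integration by parts (`integral_exp_mul_gradient`) turns the pairing with `e^{nu}` into the
  coefficient of `e^{nu}` of degree two, and the pairing with `1` is `n u_2`. As `v_2 = (n + 1)! u_2`,
  the two contributions cancel exactly when `α = 1 / (n + 1)`, the value at which the linearized
  equation degenerates in degree two. Hence `∫ v x (1 - x²) u' = 0`.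
* On the other hand, `(n - 1)! (1 - x²) u' = ∑ v_k (R_{k-1} - R_{k+1})`, and the recurrence for
  multiplication by `x` gives (`sum_pairing_eq`, in the limit)
  `(n - 1)! ∫ v x (1 - x²) u' = v_1² / 2 + (n - 1) / 2 ∑ (v_k - v_{k+2})² / (2 k + n + 1)`.

So all `v_k` vanish (`coeff_eq_zero_of_pairing`) and `u` is constant.

These manipulations need some regularity. Since `v` is integrable, `v_k → 0`; together with the
decay of `R_k` away from the poles (`exists_abs_zonal_le`, from the monotonicity of the energy
`R² + (1 - x²) R'² / λ`), this bounds the series of `u` by a small multiple of `log (1 / (1 - x²))`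
up to a constant (`exists_abs_potential_le`). Hence `e^{nu}` and `v` are square integrable,
Bessel's inequality improves the decay of `v_k`, and the series of `u` can be differentiated term by
term on `(-1, 1)` (`hasDerivAt_potential`).
-/

namespace PaneitzSphere

open Filter Topology

variable {n : ℕ}

/-! ### Zonal polynomials -/

open Polynomial in
/-- The zonal spherical polynomial of degree `k` on `𝕊ⁿ`: the Gegenbauer polynomial of parameter
`(n - 1) / 2`, normalized to take the value `1` at `1`. -/
noncomputable def zonalPoly (n : ℕ) : ℕ → Polynomial ℝ
  | 0 => 1
  | 1 => X
  | k + 2 => C ((2 * k + n + 1) / (k + n) : ℝ) * X * zonalPoly n (k + 1)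
      - C ((k + 1) / (k + n) : ℝ) * zonalPoly n k

/-- The zonal polynomials as functions. -/
noncomputable def zonal (n k : ℕ) (x : ℝ) : ℝ := (zonalPoly n k).eval x

/-- The derivatives of the zonal polynomials as functions. -/
noncomputable def zonalDeriv (n k : ℕ) (x : ℝ) : ℝ := (zonalPoly n k).derivative.eval x

@[simp] lemma zonal_zero (x : ℝ) : zonal n 0 x = 1 := by simp [zonal, zonalPoly]

@[simp] lemma zonal_one (x : ℝ) : zonal n 1 x = x := by simp [zonal, zonalPoly]

lemma zonal_add_two (hn : 2 ≤ n) (k : ℕ) (x : ℝ) :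
    (k + n) * zonal n (k + 2) x = (2 * k + n + 1) * x * zonal n (k + 1) x
      - (k + 1) * zonal n k x := by
  have h : (k + n : ℝ) ≠ 0 := by positivity
  simp only [zonal, zonalPoly, Polynomial.eval_sub, Polynomial.eval_mul, Polynomial.eval_C,
    Polynomial.eval_X]
  field_simp

lemma zonalDeriv_add_two (hn : 2 ≤ n) (k : ℕ) (x : ℝ) :
    (k + n) * zonalDeriv n (k + 2) x = (2 * k + n + 1) * (zonal n (k + 1) x
      + x * zonalDeriv n (k + 1) x) - (k + 1) * zonalDeriv n k x := by
  have h : (k + n : ℝ) ≠ 0 := by positivity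
  simp only [zonal, zonalDeriv, zonalPoly, Polynomial.derivative_sub, Polynomial.derivative_mul,
    Polynomial.derivative_C, Polynomial.derivative_X, Polynomial.eval_sub, Polynomial.eval_mul,
    Polynomial.eval_C, Polynomial.eval_X, Polynomial.eval_add, Polynomial.eval_zero,
    Polynomial.eval_one]
  field_simp
  ring

lemma zonalDeriv_structure (hn : 2 ≤ n) (k : ℕ) (x : ℝ) :
    (1 - x ^ 2) * zonalDeriv n k x = (k + n - 1) * (x * zonal n k x - zonal n (k + 1) x) ∧
    (1 - x ^ 2) * zonalDeriv n (k + 1) x = (k + 1) * (zonal n k x - x * zonal n (k + 1) x) := by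
  induction k with
  | zero => simp [zonalDeriv, zonalPoly]; ring
  | succ k ih =>
    obtain ⟨ha, hb⟩ := ih
    have h : (k + n : ℝ) ≠ 0 := by positivity
    have hr := zonal_add_two hn k x
    have hd := zonalDeriv_add_two hn k x
    constructor
    · push_cast
      rw [hb]; linear_combination hr
    · push_cast
      apply mul_left_cancel₀ h
      linear_combination (1 - x ^ 2) * hd + (2 * k + n + 1) * x * hb - (k + 1) * ha +
        (k + 2) * x * hr

lemma one_sub_sq_mul_zonalDeriv (hn : 2 ≤ n) (k : ℕ) (x : ℝ) :
    (1 - x ^ 2) * zonalDeriv n k x = (k + n - 1) * (x * zonal n k x - zonal n (k + 1) x) :=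
  (zonalDeriv_structure hn k x).1

lemma one_sub_sq_mul_zonalDeriv_succ (hn : 2 ≤ n) (k : ℕ) (x : ℝ) :
    (1 - x ^ 2) * zonalDeriv n (k + 1) x = (k + 1) * (zonal n k x - x * zonal n (k + 1) x) :=
  (zonalDeriv_structure hn k x).2

lemma mul_zonal_succ (hn : 2 ≤ n) (k : ℕ) (x : ℝ) :
    x * zonal n (k + 1) x =
      ((k + n) * zonal n (k + 2) x + (k + 1) * zonal n k x) / (2 * k + n + 1) := by
  have h : (2 * k + n + 1 : ℝ) ≠ 0 := by positivity
  rw [eq_div_iff h, zonal_add_two hn]; ring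

/-- The eigenvalue equation for zonal functions:
`(1 - x²) R'' - n x R' + k (k + n - 1) R = 0`. -/
lemma zonal_ode (hn : 2 ≤ n) (k : ℕ) (x : ℝ) :
    (1 - x ^ 2) * (zonalPoly n k).derivative.derivative.eval x
      = n * x * zonalDeriv n k x - k * (k + n - 1) * zonal n k x := by
  open Polynomial in
  have key : (1 - X ^ 2 : ℝ[X]) * ((1 - X ^ 2) * (zonalPoly n k).derivative.derivative
      - (C (n : ℝ) * X * (zonalPoly n k).derivative
        - C (k * (k + n - 1) : ℝ) * zonalPoly n k)) = 0 := by
    have hpoly : (1 - X ^ 2 : ℝ[X]) * (zonalPoly n k).derivative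
        = C (k + n - 1 : ℝ) * (X * zonalPoly n k - zonalPoly n (k + 1)) := by
      refine Polynomial.funext fun t => ?_
      simpa [zonal, zonalDeriv] using one_sub_sq_mul_zonalDeriv hn k t
    have hd := congrArg Polynomial.derivative hpoly
    refine Polynomial.funext fun t => ?_
    have hd' := congrArg (Polynomial.eval t) hd
    have ha := one_sub_sq_mul_zonalDeriv hn k t
    have hb := one_sub_sq_mul_zonalDeriv_succ hn k t
    simp only [Polynomial.derivative_mul, Polynomial.derivative_sub, Polynomial.derivative_one,
      Polynomial.derivative_X_pow, Polynomial.derivative_C, Polynomial.derivative_X,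
      Polynomial.eval_mul, Polynomial.eval_sub, Polynomial.eval_add, Polynomial.eval_pow,
      Polynomial.eval_X, Polynomial.eval_C, Polynomial.eval_one, Polynomial.eval_zero] at hd' ⊢
    simp only [zonal, zonalDeriv] at ha hb
    norm_num only at hd' ⊢
    linear_combination (1 - t ^ 2) * hd' + (k + 1) * t * ha - (k + n - 1) * hb
  have hne : (1 - Polynomial.X ^ 2 : Polynomial ℝ) ≠ 0 := by
    intro h
    have := congrArg (Polynomial.eval 0) h
    simp at this
  have h0 := (mul_eq_zero.mp key).resolve_left hne
  have h1 := congrArg (Polynomial.eval x) h0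
  simp only [Polynomial.eval_mul, Polynomial.eval_sub, Polynomial.eval_pow,
      Polynomial.eval_X, Polynomial.eval_C, Polynomial.eval_one, Polynomial.eval_zero] at h1
  simp only [zonal, zonalDeriv]
  linarith

lemma zonal_at_one (hn : 2 ≤ n) (k : ℕ) : zonal n k 1 = 1 := by
  induction k using Nat.strong_induction_on with
  | _ k ih =>
    match k, ih with
    | 0, _ => simp
    | 1, _ => simp
    | k + 2, ih =>
      have h : (k + n : ℝ) ≠ 0 := by positivity
      have h2 := zonal_add_two hn k 1
      rw [ih (k + 1) (by omega), ih k (by omega)] at h2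
      apply mul_left_cancel₀ h
      linarith

lemma zonal_neg (hn : 2 ≤ n) (k : ℕ) (x : ℝ) : zonal n k (-x) = (-1) ^ k * zonal n k x := by
  induction k using Nat.strong_induction_on with
  | _ k ih =>
    match k, ih with
    | 0, _ => simp
    | 1, _ => simp
    | k + 2, ih =>
      have h : (k + n : ℝ) ≠ 0 := by positivity
      have h2 := zonal_add_two hn k (-x)
      have h3 := zonal_add_two hn k x
      rw [ih (k + 1) (by omega), ih k (by omega)] at h2
      apply mul_left_cancel₀ h
      rw [h2]
      linear_combination -(-1) ^ k * h3

lemma continuous_zonal (n k : ℕ) : Continuous (zonal n k) := (zonalPoly n k).continuous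

lemma continuous_zonalDeriv (n k : ℕ) : Continuous (zonalDeriv n k) :=
  (zonalPoly n k).derivative.continuous

lemma hasDerivAt_zonal (n k : ℕ) (x : ℝ) : HasDerivAt (zonal n k) (zonalDeriv n k x) x :=
  (zonalPoly n k).hasDerivAt x

/-- The energy `R² + (1 - x²) R'² / λ` of the zonal polynomial of degree `k`,
where `λ = k (k + n - 1)`. -/
noncomputable def zonalEnergy (n k : ℕ) (x : ℝ) : ℝ :=
  zonal n k x ^ 2 + (1 - x ^ 2) * zonalDeriv n k x ^ 2 / (k * (k + n - 1))

lemma eigenvalue_pos (hn : 2 ≤ n) {k : ℕ} (hk : 1 ≤ k) : (0 : ℝ) < k * (k + n - 1) := by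
  have h1 : (1 : ℝ) ≤ k := by exact_mod_cast hk
  have h2 : (2 : ℝ) ≤ n := by exact_mod_cast hn
  apply mul_pos <;> linarith

lemma sq_zonal_le_energy (hn : 2 ≤ n) {k : ℕ} (hk : 1 ≤ k) {x : ℝ} (hx : x ^ 2 ≤ 1) :
    zonal n k x ^ 2 ≤ zonalEnergy n k x := by
  have := eigenvalue_pos hn hk
  have h : 0 ≤ 1 - x ^ 2 := by linarith
  rw [zonalEnergy]
  have : 0 ≤ (1 - x ^ 2) * zonalDeriv n k x ^ 2 / (k * (k + n - 1)) := by positivity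
  linarith

lemma hasDerivAt_zonalEnergy (hn : 2 ≤ n) {k : ℕ} (hk : 1 ≤ k) (x : ℝ) :
    HasDerivAt (zonalEnergy n k)
      (2 * (n - 1) * x * zonalDeriv n k x ^ 2 / (k * (k + n - 1))) x := by
  have hpos := eigenvalue_pos hn hk
  have h1 := (hasDerivAt_zonal n k x).pow 2
  have h2 : HasDerivAt (zonalDeriv n k) ((zonalPoly n k).derivative.derivative.eval x) x :=
    (zonalPoly n k).derivative.hasDerivAt x
  have h3 : HasDerivAt (fun x : ℝ => 1 - x ^ 2) (-(2 * x)) x := by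
    simpa using ((hasDerivAt_id x).pow 2).const_sub 1
  have h4 := h1.add ((h3.mul (h2.pow 2)).div_const (k * (k + n - 1) : ℝ))
  refine h4.congr_deriv ?_
  have hode := zonal_ode hn k x
  simp only [Pi.pow_apply]
  rw [add_div']
  · congr 1
    norm_num
    linear_combination 2 * zonalDeriv n k x * hode
  · exact hpos.ne'

/-- The energy of a zonal polynomial increases towards the pole. -/
lemma zonalEnergy_monotoneOn (hn : 2 ≤ n) {k : ℕ} (hk : 1 ≤ k) :
    MonotoneOn (zonalEnergy n k) (Icc 0 1) := by
  have hpos := eigenvalue_pos hn hk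
  have h2 : (2 : ℝ) ≤ n := by exact_mod_cast hn
  refine monotoneOn_of_hasDerivWithinAt_nonneg (convex_Icc 0 1)
    (fun x _ => (hasDerivAt_zonalEnergy hn hk x).continuousAt.continuousWithinAt)
    (fun x _ => (hasDerivAt_zonalEnergy hn hk x).hasDerivWithinAt) ?_
  intro x hx
  rw [interior_Icc] at hx
  have : 0 ≤ x := hx.1.le
  have : (0 : ℝ) ≤ n - 1 := by linarith
  positivity

lemma abs_zonal_neg (hn : 2 ≤ n) (k : ℕ) (x : ℝ) : |zonal n k (-x)| = |zonal n k x| := by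
  rw [zonal_neg hn, abs_mul, abs_pow]; simp

lemma abs_zonal_abs (hn : 2 ≤ n) (k : ℕ) (x : ℝ) : |zonal n k (|x|)| = |zonal n k x| := by
  rcases abs_choice x with h | h <;> rw [h]
  exact abs_zonal_neg hn k x

lemma abs_zonal_le_one (hn : 2 ≤ n) (k : ℕ) {x : ℝ} (hx : x ^ 2 ≤ 1) : |zonal n k x| ≤ 1 := by
  rcases Nat.eq_zero_or_pos k with rfl | hk
  · simp
  rw [← abs_zonal_abs hn]
  have h1 : |x| ≤ 1 := (sq_le_one_iff_abs_le_one x).mp hx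
  have h2 := sq_zonal_le_energy hn hk (show |x| ^ 2 ≤ 1 by rwa [sq_abs])
  have h3 := zonalEnergy_monotoneOn hn hk ⟨abs_nonneg x, h1⟩ (right_mem_Icc.mpr zero_le_one) h1
  have h4 : zonalEnergy n k 1 = 1 := by simp [zonalEnergy, zonal_at_one hn]
  exact (sq_le_one_iff_abs_le_one _).mp (by linarith)

/-! ### The zonal measure, orthogonality and decay -/

/-- The unnormalized density `(1 - x²)^(n/2 - 1)` of the first coordinate on `𝕊ⁿ`. -/
noncomputable def zonalWeight (n : ℕ) (x : ℝ) : ℝ := (1 - x ^ 2) ^ ((n : ℝ) / 2 - 1)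

/-- The total mass of the density `zonalWeight n` on `(-1, 1)`. -/
noncomputable def zonalMass (n : ℕ) : ℝ := ∫ x in Ioo (-1 : ℝ) 1, zonalWeight n x

/-- The probability measure on `(-1, 1)` with density proportional to `(1 - x²)^(n/2 - 1)`,
which is the law of the first coordinate on `𝕊ⁿ`. -/
noncomputable def zonalMeasure (n : ℕ) : Measure ℝ :=
  (volume.restrict (Ioo (-1 : ℝ) 1)).withDensity
    fun x => ENNReal.ofReal ((zonalMass n)⁻¹ * zonalWeight n x)

lemma one_sub_sq_pos {x : ℝ} (hx : x ∈ Ioo (-1 : ℝ) 1) : 0 < 1 - x ^ 2 := by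
  nlinarith [hx.1, hx.2]

lemma one_sub_sq_le_one (x : ℝ) : 1 - x ^ 2 ≤ 1 := by nlinarith [sq_nonneg x]

lemma zonalWeight_pos {x : ℝ} (hx : x ∈ Ioo (-1 : ℝ) 1) : 0 < zonalWeight n x :=
  Real.rpow_pos_of_pos (one_sub_sq_pos hx) _

lemma half_sub_one_nonneg (hn : 2 ≤ n) : (0 : ℝ) ≤ (n : ℝ) / 2 - 1 := by
  have : (2 : ℝ) ≤ n := by exact_mod_cast hn
  linarith

lemma zonalWeight_le_one (hn : 2 ≤ n) {x : ℝ} (hx : x ∈ Ioo (-1 : ℝ) 1) : zonalWeight n x ≤ 1 :=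
  Real.rpow_le_one (one_sub_sq_pos hx).le (one_sub_sq_le_one x) (half_sub_one_nonneg hn)

lemma measurable_zonalWeight : Measurable (zonalWeight n) := by
  unfold zonalWeight; fun_prop

lemma integrableOn_zonalWeight (hn : 2 ≤ n) :
    IntegrableOn (zonalWeight n) (Ioo (-1 : ℝ) 1) := by
  refine Measure.integrableOn_of_bounded (M := 1) (by simp)
    measurable_zonalWeight.aestronglyMeasurable ?_
  filter_upwards [ae_restrict_mem measurableSet_Ioo] with x hx
  rw [Real.norm_of_nonneg (zonalWeight_pos hx).le]
  exact zonalWeight_le_one hn hx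

lemma zonalMass_pos (hn : 2 ≤ n) : 0 < zonalMass n := by
  rw [zonalMass, setIntegral_pos_iff_support_of_nonneg_ae _ (integrableOn_zonalWeight hn)]
  · have : Function.support (zonalWeight n) ∩ Ioo (-1 : ℝ) 1 = Ioo (-1) 1 :=
      inter_eq_right.mpr fun x hx => (zonalWeight_pos hx).ne'
    rw [this]; simp
  · filter_upwards [ae_restrict_mem measurableSet_Ioo] with x hx using (zonalWeight_pos hx).le

lemma integral_zonalMeasure (hn : 2 ≤ n) (h : ℝ → ℝ) :
    ∫ x, h x ∂(zonalMeasure n) = ∫ x in Ioo (-1 : ℝ) 1, (zonalMass n)⁻¹ * zonalWeight n x * h x := by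
  rw [zonalMeasure, integral_withDensity_eq_integral_toReal_smul
    ((measurable_zonalWeight.const_mul _).ennreal_ofReal) (by simp)]
  refine setIntegral_congr_fun measurableSet_Ioo fun x hx => ?_
  have := zonalMass_pos hn
  have := zonalWeight_pos (n := n) hx
  simp only [smul_eq_mul]
  rw [ENNReal.toReal_ofReal (by positivity)]

lemma integrable_zonalMeasure_iff (hn : 2 ≤ n) (h : ℝ → ℝ) :
    Integrable h (zonalMeasure n) ↔
      IntegrableOn (fun x => (zonalMass n)⁻¹ * zonalWeight n x * h x) (Ioo (-1 : ℝ) 1) := by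
  rw [zonalMeasure, integrable_withDensity_iff_integrable_smul'
    ((measurable_zonalWeight.const_mul _).ennreal_ofReal) (by simp)]
  refine integrableOn_congr_fun (fun x hx => ?_) measurableSet_Ioo
  have := zonalMass_pos hn
  have := zonalWeight_pos (n := n) hx
  simp only [smul_eq_mul]
  rw [ENNReal.toReal_ofReal (by positivity)]

lemma ae_zonalMeasure_mem (n : ℕ) : ∀ᵐ x ∂(zonalMeasure n), x ∈ Ioo (-1 : ℝ) 1 :=
  (withDensity_absolutelyContinuous _ _).ae_le (ae_restrict_mem measurableSet_Ioo)

lemma isProbabilityMeasure_zonalMeasure (hn : 2 ≤ n) : IsProbabilityMeasure (zonalMeasure n) := by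
  have hm := zonalMass_pos hn
  refine ⟨?_⟩
  rw [zonalMeasure, withDensity_apply _ MeasurableSet.univ, Measure.restrict_univ,
    ← ofReal_integral_eq_lintegral_ofReal ((integrableOn_zonalWeight hn).const_mul _)]
  · rw [integral_const_mul, ← zonalMass, inv_mul_cancel₀ hm.ne', ENNReal.ofReal_one]
  · filter_upwards [ae_restrict_mem measurableSet_Ioo] with x hx
    have := zonalWeight_pos (n := n) hx
    simp only [Pi.zero_apply]
    positivity

lemma integrable_of_continuous (hn : 2 ≤ n) {h : ℝ → ℝ} (hc : Continuous h) :
    Integrable h (zonalMeasure n) := by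
  have := isProbabilityMeasure_zonalMeasure hn
  obtain ⟨C, hC⟩ := (isCompact_Icc (a := (-1 : ℝ)) (b := 1)).exists_bound_of_continuousOn
    hc.continuousOn
  refine Integrable.of_bound hc.aestronglyMeasurable C ?_
  filter_upwards [ae_zonalMeasure_mem n] with x hx using hC x (Ioo_subset_Icc_self hx)

/-- Integration by parts against the density `(1 - x²)^(n/2 - 1)`, in divergence form. -/
lemma integral_divergence (hn : 2 ≤ n) {F F' : ℝ → ℝ}
    (hF : ∀ x ∈ Ioo (-1 : ℝ) 1, HasDerivAt F (F' x) x)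
    (hint : Integrable (fun x => (1 - x ^ 2) * F' x - n * x * F x) (zonalMeasure n))
    (hl : Tendsto (fun x => (1 - x ^ 2) ^ ((n : ℝ) / 2) * F x) (𝓝[>] (-1)) (𝓝 0))
    (hr : Tendsto (fun x => (1 - x ^ 2) ^ ((n : ℝ) / 2) * F x) (𝓝[<] 1) (𝓝 0)) :
    ∫ x, ((1 - x ^ 2) * F' x - n * x * F x) ∂(zonalMeasure n) = 0 := by
  have hm := zonalMass_pos hn
  rw [integrable_zonalMeasure_iff hn] at hint
  rw [integral_zonalMeasure hn, ← integral_Ioc_eq_integral_Ioo,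
    ← intervalIntegral.integral_of_le (by norm_num)]
  have hd : ∀ x ∈ Ioo (-1 : ℝ) 1,
      HasDerivAt (fun x => (zonalMass n)⁻¹ * ((1 - x ^ 2) ^ ((n : ℝ) / 2) * F x))
        ((zonalMass n)⁻¹ * zonalWeight n x * ((1 - x ^ 2) * F' x - n * x * F x)) x := by
    intro x hx
    have hy := one_sub_sq_pos hx
    have h3 : HasDerivAt (fun x : ℝ => 1 - x ^ 2) (-(2 * x)) x := by
      simpa using ((hasDerivAt_id x).pow 2).const_sub 1
    have h4 := ((h3.rpow_const (p := (n : ℝ) / 2) (Or.inl hy.ne')).mul (hF x hx)).const_mul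
      (zonalMass n)⁻¹
    refine h4.congr_deriv ?_
    have h5 : (1 - x ^ 2) ^ ((n : ℝ) / 2) = zonalWeight n x * (1 - x ^ 2) := by
      rw [zonalWeight, ← Real.rpow_add_one hy.ne']; ring_nf
    rw [h5, zonalWeight]
    ring
  rw [intervalIntegral.integral_eq_sub_of_hasDerivAt_of_tendsto (by norm_num) hd
    (fa := 0) (fb := 0)]
  · simp
  · rw [intervalIntegrable_iff_integrableOn_Ioo_of_le (by norm_num)]; exact hint
  · simpa using hl.const_mul (zonalMass n)⁻¹
  · simpa using hr.const_mul (zonalMass n)⁻¹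

lemma tendsto_rpow_mul_of_continuous (hn : 2 ≤ n) {F : ℝ → ℝ} (hc : Continuous F) {a : ℝ}
    (ha : a ^ 2 = 1) :
    Tendsto (fun x => (1 - x ^ 2) ^ ((n : ℝ) / 2) * F x) (𝓝 a) (𝓝 0) := by
  have hn' : (0 : ℝ) < (n : ℝ) / 2 := by positivity
  have h : Continuous fun x : ℝ => (1 - x ^ 2) ^ ((n : ℝ) / 2) * F x :=
    ((continuous_const.sub (continuous_id.pow 2)).rpow_const fun _ => Or.inr hn'.le).mul hc
  have := h.tendsto a
  rwa [ha, sub_self, Real.zero_rpow hn'.ne', zero_mul] at this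

lemma integral_divergence_of_continuous (hn : 2 ≤ n) {F F' : ℝ → ℝ}
    (hF : ∀ x, HasDerivAt F (F' x) x) (hF' : Continuous F') :
    ∫ x, ((1 - x ^ 2) * F' x - n * x * F x) ∂(zonalMeasure n) = 0 := by
  have hc : Continuous F := continuous_iff_continuousAt.mpr fun x => (hF x).continuousAt
  refine integral_divergence hn (fun x _ => hF x) (integrable_of_continuous hn (by fun_prop)) ?_ ?_
  · exact (tendsto_rpow_mul_of_continuous hn hc (by norm_num)).mono_left nhdsWithin_le_nhds
  · exact (tendsto_rpow_mul_of_continuous hn hc (by norm_num)).mono_left nhdsWithin_le_nhds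

/-- The zonal Laplacian is symmetric, and its quadratic form is the Dirichlet form. -/
lemma integral_dirichlet (hn : 2 ≤ n) (j k : ℕ) :
    ∫ x, (1 - x ^ 2) * (zonalDeriv n j x * zonalDeriv n k x) ∂(zonalMeasure n)
      = k * (k + n - 1) * ∫ x, zonal n j x * zonal n k x ∂(zonalMeasure n) := by
  have h2 : ∀ x, HasDerivAt (zonalDeriv n k) ((zonalPoly n k).derivative.derivative.eval x) x :=
    fun x => (zonalPoly n k).derivative.hasDerivAt x
  have hcj := continuous_zonal n j
  have hck := continuous_zonal n k
  have hdj := continuous_zonalDeriv n j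
  have hdk := continuous_zonalDeriv n k
  have hddk : Continuous fun x => (zonalPoly n k).derivative.derivative.eval x :=
    (zonalPoly n k).derivative.derivative.continuous
  have h := integral_divergence_of_continuous hn
    (fun x => (hasDerivAt_zonal n j x).mul (h2 x)) (by fun_prop)
  have he : ∀ x, (1 - x ^ 2) * (zonalDeriv n j x * zonalDeriv n k x + zonal n j x *
      (zonalPoly n k).derivative.derivative.eval x) - n * x * (zonal n j * zonalDeriv n k) x
      = (1 - x ^ 2) * (zonalDeriv n j x * zonalDeriv n k x)
        - k * (k + n - 1) * (zonal n j x * zonal n k x) := by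
    intro x
    have := zonal_ode hn k x
    simp only [Pi.mul_apply]
    linear_combination zonal n j x * this
  simp_rw [he] at h
  rw [integral_sub (integrable_of_continuous hn (by fun_prop))
    (integrable_of_continuous hn (by fun_prop)), integral_const_mul] at h
  linarith

lemma integral_zonal_mul_of_ne (hn : 2 ≤ n) {j k : ℕ} (hjk : j ≠ k) :
    ∫ x, zonal n j x * zonal n k x ∂(zonalMeasure n) = 0 := by
  have h1 := integral_dirichlet hn j k
  have h2 := integral_dirichlet hn k j
  simp_rw [mul_comm (zonalDeriv n k _), mul_comm (zonal n k _)] at h2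
  rw [h1] at h2
  have h3 : ((k : ℝ) - j) * (k + j + n - 1) *
      ∫ x, zonal n j x * zonal n k x ∂(zonalMeasure n) = 0 := by linear_combination h2
  have hn' : (2 : ℝ) ≤ n := by exact_mod_cast hn
  have h4 : (k : ℝ) + j + n - 1 ≠ 0 := by
    have : (0 : ℝ) ≤ k := by positivity
    have : (0 : ℝ) ≤ j := by positivity
    intro h; linarith
  have h5 : (k : ℝ) - j ≠ 0 := sub_ne_zero.mpr (by exact_mod_cast hjk.symm)
  simpa [h4, h5] using h3

/-- The squared `L²` norm of the zonal polynomial of degree `k`. -/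
noncomputable def zonalNormSq (n k : ℕ) : ℝ := ∫ x, zonal n k x * zonal n k x ∂(zonalMeasure n)

lemma zonalNormSq_zero (hn : 2 ≤ n) : zonalNormSq n 0 = 1 := by
  have := isProbabilityMeasure_zonalMeasure hn
  simp [zonalNormSq]

lemma integrable_zonal_mul (hn : 2 ≤ n) (j k : ℕ) :
    Integrable (fun x => zonal n j x * zonal n k x) (zonalMeasure n) :=
  integrable_of_continuous hn ((continuous_zonal n j).mul (continuous_zonal n k))

lemma zonalNormSq_succ (hn : 2 ≤ n) (k : ℕ) :
    (2 * k + n + 1) * (k + n - 1) * zonalNormSq n (k + 1)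
      = (2 * k + n - 1) * (k + 1) * zonalNormSq n k := by
  -- both sides are multiples of `∫ x R_k R_{k+1}`, by the recurrence at degrees `k` and `k + 1`
  have h1 : ∫ x, x * zonal n (k + 1) x * zonal n k x ∂(zonalMeasure n)
      = (k + 1) / (2 * k + n + 1) * zonalNormSq n k := by
    have : ∀ x, x * zonal n (k + 1) x * zonal n k x
        = (k + n) / (2 * k + n + 1) * (zonal n (k + 2) x * zonal n k x)
          + (k + 1) / (2 * k + n + 1) * (zonal n k x * zonal n k x) := by
      intro x; rw [mul_zonal_succ hn]; ring
    simp_rw [this]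
    rw [integral_add ((integrable_zonal_mul hn _ _).const_mul _)
      ((integrable_zonal_mul hn _ _).const_mul _), integral_const_mul, integral_const_mul,
      integral_zonal_mul_of_ne hn (by omega), zonalNormSq]
    ring
  have h2 : (2 * k + n - 1) * ∫ x, x * zonal n (k + 1) x * zonal n k x ∂(zonalMeasure n)
      = (k + n - 1) * zonalNormSq n (k + 1) := by
    rcases k with _ | k
    · simp [zonalNormSq]
    · have : ∀ x, x * zonal n (k + 1 + 1) x * zonal n (k + 1) x
        = (k + n) / (2 * k + n + 1) * (zonal n (k + 2) x * zonal n (k + 2) x)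
          + (k + 1) / (2 * k + n + 1) * (zonal n k x * zonal n (k + 2) x) := by
        intro x
        have := mul_zonal_succ hn k x
        calc _ = zonal n (k + 2) x * (x * zonal n (k + 1) x) := by ring
          _ = _ := by rw [this]; ring
      simp_rw [this]
      rw [integral_add ((integrable_zonal_mul hn _ _).const_mul _)
        ((integrable_zonal_mul hn _ _).const_mul _), integral_const_mul, integral_const_mul,
        integral_zonal_mul_of_ne hn (by omega : k ≠ k + 2), zonalNormSq]
      have : (2 * k + n + 1 : ℝ) ≠ 0 := by positivity
      push_cast
      field_simp
      ring
  have h3 : (2 * k + n + 1 : ℝ) ≠ 0 := by positivity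
  rw [h1] at h2
  field_simp at h2
  linarith

lemma zonalNormSq_nonneg (n k : ℕ) : 0 ≤ zonalNormSq n k :=
  integral_nonneg fun _ => mul_self_nonneg _

lemma zonalNormSq_pos (hn : 2 ≤ n) (k : ℕ) : 0 < zonalNormSq n k := by
  have hn' : (2 : ℝ) ≤ n := by exact_mod_cast hn
  induction k with
  | zero => rw [zonalNormSq_zero hn]; exact one_pos
  | succ k ih =>
    have h := zonalNormSq_succ hn k
    have h1 : (0 : ℝ) < 2 * k + n - 1 := by
      have : (0 : ℝ) ≤ k := by positivity
      linarith
    have h2 : (0 : ℝ) < k + n - 1 := by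
      have : (0 : ℝ) ≤ k := by positivity
      linarith
    have h3 : 0 < (2 * k + n + 1) * (k + n - 1) * zonalNormSq n (k + 1) := by
      rw [h]; positivity
    exact pos_of_mul_pos_right h3 (by positivity)

lemma zonalNormSq_le (hn : 2 ≤ n) (k : ℕ) : zonalNormSq n k ≤ 1 / (k + 1) := by
  have hn' : (2 : ℝ) ≤ n := by exact_mod_cast hn
  induction k with
  | zero => rw [zonalNormSq_zero hn]; simp
  | succ k ih =>
    have h := zonalNormSq_succ hn k
    have h0 : (0 : ℝ) ≤ k := by positivity
    have h1 : (0 : ℝ) < 2 * k + n - 1 := by linarith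
    have h2 : (0 : ℝ) < k + n - 1 := by linarith
    have h3 : (0 : ℝ) < (2 * k + n + 1) * (k + n - 1) := by positivity
    rw [le_div_iff₀ (by positivity)] at ih ⊢
    push_cast
    have h4 : (2 * k + n - 1 : ℝ) * (k + 2) ≤ (2 * k + n + 1) * (k + n - 1) := by
      nlinarith [sq_nonneg ((n : ℝ) - 1), mul_nonneg h0 (sub_nonneg.mpr hn')]
    have h5 : (2 * k + n + 1) * (k + n - 1) * (zonalNormSq n (k + 1) * (k + 1 + 1))
        ≤ (2 * k + n + 1) * (k + n - 1) * 1 := by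
      calc _ = (2 * k + n - 1) * (k + 2) * (zonalNormSq n k * (k + 1)) := by
            linear_combination (k + 2) * h
        _ ≤ (2 * k + n - 1) * (k + 2) * 1 := by gcongr
        _ ≤ _ := by linarith
    exact le_of_mul_le_mul_left h5 h3

lemma integral_zonalEnergy (hn : 2 ≤ n) {k : ℕ} (hk : 1 ≤ k) :
    ∫ x, zonalEnergy n k x ∂(zonalMeasure n) = 2 * zonalNormSq n k := by
  have hpos := eigenvalue_pos hn hk
  have hck := continuous_zonal n k
  have hdk := continuous_zonalDeriv n k
  have h := integral_dirichlet hn k k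
  have : ∀ x, zonalEnergy n k x = zonal n k x * zonal n k x +
      (k * (k + n - 1) : ℝ)⁻¹ * ((1 - x ^ 2) * (zonalDeriv n k x * zonalDeriv n k x)) := by
    intro x; rw [zonalEnergy]; ring
  simp_rw [this]
  rw [integral_add (integrable_zonal_mul hn _ _) (integrable_of_continuous hn (by fun_prop)),
    integral_const_mul, h, ← zonalNormSq, inv_mul_cancel_left₀ hpos.ne']
  ring

/-- Pointwise decay of the zonal polynomials away from the poles: the energy at `x` is at most
its average over the half of `[x, 1]` next to `x`, which the `L²` norm controls. -/
lemma exists_sq_zonal_le (hn : 2 ≤ n) : ∃ C : ℝ, 0 < C ∧ ∀ k, 1 ≤ k → ∀ x ∈ Ioo (-1 : ℝ) 1,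
    (1 - x ^ 2) ^ ((n : ℝ) / 2) * zonal n k x ^ 2 ≤ C * zonalNormSq n k := by
  have hm := zonalMass_pos hn
  refine ⟨2 * zonalMass n * 4 ^ ((n : ℝ) / 2), by positivity, fun k hk => ?_⟩
  suffices H : ∀ x ∈ Ico (0 : ℝ) 1, (1 - x ^ 2) ^ ((n : ℝ) / 2) * zonal n k x ^ 2 ≤
      2 * zonalMass n * 4 ^ ((n : ℝ) / 2) * zonalNormSq n k by
    intro x hx
    have h := H |x| ⟨abs_nonneg x, abs_lt.mpr hx⟩
    rwa [← sq_abs (zonal n k (|x|)), abs_zonal_abs hn, sq_abs, sq_abs] at h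
  intro x hx
  have hx' : x ∈ Ioo (-1 : ℝ) 1 := ⟨by linarith [hx.1], hx.2⟩
  have hy := one_sub_sq_pos hx'
  have hcE : Continuous (zonalEnergy n k) := continuous_iff_continuousAt.mpr
    fun x => (hasDerivAt_zonalEnergy hn hk x).continuousAt
  have hE0 : ∀ t ∈ Ioo (-1 : ℝ) 1, 0 ≤ zonalEnergy n k t := fun t ht =>
    (sq_nonneg _).trans (sq_zonal_le_energy hn hk (by linarith [one_sub_sq_pos ht]))
  have hEx := sq_zonal_le_energy (n := n) hn hk (x := x) (by linarith)
  have hint := (integrable_zonalMeasure_iff hn _).mp (integrable_of_continuous hn hcE)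
  have hsub : Icc x ((1 + x) / 2) ⊆ Ioo (-1 : ℝ) 1 := fun t ht =>
    ⟨by linarith [ht.1, hx.1], by linarith [ht.2, hx.2]⟩
  set c : ℝ := (zonalMass n)⁻¹ * ((1 - x ^ 2) / 4) ^ ((n : ℝ) / 2 - 1) * zonalEnergy n k x
  have hc0 : 0 ≤ c := by
    have := hE0 x hx'
    positivity
  have h1 : c * volume.real (Icc x ((1 + x) / 2)) ≤
      ∫ t in Icc x ((1 + x) / 2), (zonalMass n)⁻¹ * zonalWeight n t * zonalEnergy n k t := by
    refine setIntegral_ge_of_const_le_real measurableSet_Icc (by simp) ?_ (hint.mono_set hsub)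
    intro t ht
    have htm := zonalEnergy_monotoneOn hn hk ⟨hx.1, hx.2.le⟩
      ⟨by linarith [ht.1, hx.1], (hsub ht).2.le⟩ ht.1
    have hw : ((1 - x ^ 2) / 4) ^ ((n : ℝ) / 2 - 1) ≤ zonalWeight n t :=
      Real.rpow_le_rpow (by positivity) (by nlinarith [ht.1, ht.2, hx.1, hx.2])
        (half_sub_one_nonneg hn)
    have := hE0 x hx'
    have := zonalWeight_pos (n := n) (hsub ht)
    simp only [c]
    gcongr
  have h2 : ∫ t in Icc x ((1 + x) / 2), (zonalMass n)⁻¹ * zonalWeight n t * zonalEnergy n k t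
      ≤ 2 * zonalNormSq n k := by
    rw [← integral_zonalEnergy hn hk, integral_zonalMeasure hn]
    refine setIntegral_mono_set hint ?_ hsub.eventuallyLE
    filter_upwards [ae_restrict_mem measurableSet_Ioo] with t ht
    have := hE0 t ht
    have := zonalWeight_pos (n := n) ht
    simp only [Pi.zero_apply]
    positivity
  have h3 : (1 - x ^ 2) / 4 ≤ volume.real (Icc x ((1 + x) / 2)) := by
    rw [Real.volume_real_Icc_of_le (by linarith [hx.2])]
    nlinarith [hx.1, hx.2]
  have h4 : c * ((1 - x ^ 2) / 4) ≤ 2 * zonalNormSq n k :=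
    ((mul_le_mul_of_nonneg_left h3 hc0).trans h1).trans h2
  have h5 : c * ((1 - x ^ 2) / 4) =
      (zonalMass n)⁻¹ * ((1 - x ^ 2) ^ ((n : ℝ) / 2) / 4 ^ ((n : ℝ) / 2)) * zonalEnergy n k x := by
    rw [← Real.div_rpow hy.le (by norm_num)]
    have : ((1 - x ^ 2) / 4) ^ ((n : ℝ) / 2)
        = ((1 - x ^ 2) / 4) ^ ((n : ℝ) / 2 - 1) * ((1 - x ^ 2) / 4) := by
      rw [← Real.rpow_add_one (by positivity)]; ring_nf
    rw [this]; ring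
  rw [h5] at h4
  calc (1 - x ^ 2) ^ ((n : ℝ) / 2) * zonal n k x ^ 2
      ≤ (1 - x ^ 2) ^ ((n : ℝ) / 2) * zonalEnergy n k x := by gcongr
    _ = zonalMass n * 4 ^ ((n : ℝ) / 2) * ((zonalMass n)⁻¹ *
        ((1 - x ^ 2) ^ ((n : ℝ) / 2) / 4 ^ ((n : ℝ) / 2)) * zonalEnergy n k x) := by
      have : (4 : ℝ) ^ ((n : ℝ) / 2) ≠ 0 := by positivity
      field_simp
    _ ≤ zonalMass n * 4 ^ ((n : ℝ) / 2) * (2 * zonalNormSq n k) := by gcongr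
    _ = _ := by ring

/-- Completeness of the zonal polynomials: an integrable function orthogonal to all of them is
orthogonal to all polynomials, hence to all continuous functions, and vanishes. -/
lemma ae_eq_zero_of_integral_zonal_eq_zero (hn : 2 ≤ n) {h : ℝ → ℝ}
    (hint : Integrable h (zonalMeasure n))
    (h0 : ∀ k, ∫ x, h x * zonal n k x ∂(zonalMeasure n) = 0) : h =ᵐ[zonalMeasure n] 0 := by
  have := isProbabilityMeasure_zonalMeasure hn
  have hmul : ∀ q : ℝ → ℝ, Continuous q → Integrable (fun x => h x * q x) (zonalMeasure n) := by
    intro q hq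
    obtain ⟨C, hC⟩ := (isCompact_Icc (a := (-1 : ℝ)) (b := 1)).exists_bound_of_continuousOn
      hq.continuousOn
    refine hint.mul_bdd (c := C) hq.aestronglyMeasurable ?_
    filter_upwards [ae_zonalMeasure_mem n] with x hx using hC x (Ioo_subset_Icc_self hx)
  have hpow : ∀ m k : ℕ, ∫ x, h x * (x ^ m * zonal n k x) ∂(zonalMeasure n) = 0 := by
    intro m
    induction m with
    | zero => simpa using h0
    | succ m ih =>
      have hi : ∀ k, Integrable (fun x => h x * (x ^ m * zonal n k x)) (zonalMeasure n) :=
        fun k => hmul _ (by have := continuous_zonal n k; fun_prop)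
      rintro (_ | k)
      · have := ih 1
        simpa [pow_succ] using this
      · have : ∀ x, h x * (x ^ (m + 1) * zonal n (k + 1) x) =
            (k + n) / (2 * k + n + 1) * (h x * (x ^ m * zonal n (k + 2) x))
            + (k + 1) / (2 * k + n + 1) * (h x * (x ^ m * zonal n k x)) := by
          intro x
          calc _ = h x * x ^ m * (x * zonal n (k + 1) x) := by ring
            _ = _ := by rw [mul_zonal_succ hn]; ring
        simp_rw [this]
        rw [integral_add ((hi _).const_mul _) ((hi _).const_mul _), integral_const_mul,
          integral_const_mul, ih, ih]
        simp
  have hpoly : ∀ q : Polynomial ℝ, ∫ x, h x * q.eval x ∂(zonalMeasure n) = 0 := by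
    intro q
    induction q using Polynomial.induction_on' with
    | add p q hp hq =>
      simp_rw [Polynomial.eval_add, mul_add]
      rw [integral_add (hmul _ p.continuous) (hmul _ q.continuous), hp, hq, add_zero]
    | monomial m a =>
      have h1 := hpow m 0
      simp only [zonal_zero, mul_one] at h1
      simp_rw [Polynomial.eval_monomial, mul_left_comm _ a]
      rw [integral_const_mul, h1, mul_zero]
  refine ae_eq_zero_of_integral_contDiff_smul_eq_zero hint.locallyIntegrable fun g hg _ => ?_
  have hgc := hg.continuous
  have hsmall : ∀ ε > 0, |∫ x, h x * g x ∂(zonalMeasure n)|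
      ≤ ε * ∫ x, |h x| ∂(zonalMeasure n) := by
    intro ε hε
    obtain ⟨p, hp⟩ := exists_polynomial_near_of_continuousOn (-1) 1 g hgc.continuousOn ε hε
    have h1 : ∫ x, h x * g x ∂(zonalMeasure n)
        = ∫ x, h x * (g x - p.eval x) ∂(zonalMeasure n) := by
      simp_rw [mul_sub]
      rw [integral_sub (hmul _ hgc) (hmul _ p.continuous), hpoly, sub_zero]
    rw [h1, ← integral_const_mul]
    refine abs_integral_le_integral_abs.trans (integral_mono_ae
      (hmul _ (hgc.sub p.continuous)).abs (hint.abs.const_mul _) ?_)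
    filter_upwards [ae_zonalMeasure_mem n] with x hx
    rw [abs_mul, mul_comm ε]
    gcongr
    rw [abs_sub_comm]
    exact (hp x (Ioo_subset_Icc_self hx)).le
  simp_rw [smul_eq_mul, mul_comm (g _)]
  by_contra hne
  have hpos := abs_pos.mpr hne
  have hH : 0 ≤ ∫ x, |h x| ∂(zonalMeasure n) := integral_nonneg fun x => abs_nonneg _
  have h2 := hsmall (|∫ x, h x * g x ∂(zonalMeasure n)| / (2 * (1 + ∫ x, |h x| ∂(zonalMeasure n))))
    (by positivity)
  rw [div_mul_eq_mul_div, le_div_iff₀ (by positivity)] at h2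
  nlinarith

/-! ### Zonal polynomials as eigenfunctions on the sphere -/

lemma hasDerivAt_inv_norm {E : Type*} [NormedAddCommGroup E] [InnerProductSpace ℝ E]
    {c : ℝ → E} {v : E} {t : ℝ} (hc : HasDerivAt c v t) (h0 : c t ≠ 0) :
    HasDerivAt (fun s => ‖c s‖⁻¹) (-(inner ℝ (c t) v * ‖c t‖⁻¹ ^ 3)) t := by
  have hpos : 0 < ‖c t‖ := norm_pos_iff.mpr h0
  have h1 := (hc.norm_sq.sqrt (by positivity)).inv (by positivity)
  simp only [Real.sqrt_sq (norm_nonneg _)] at h1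
  refine h1.congr_deriv ?_
  field_simp

/-- Second derivatives, in the direction of a unit vector and at a point of the unit sphere, of a
function of the first coordinate extended to be constant along rays. -/
lemma fderiv_fderiv_comp_radial (q : Polynomial ℝ) {ξ v : EuclideanSpace ℝ (Fin (n + 1))}
    (hξ : ‖ξ‖ = 1) (hv : ‖v‖ = 1) :
    fderiv ℝ (fderiv ℝ fun x : EuclideanSpace ℝ (Fin (n + 1)) => q.eval (‖x‖⁻¹ * x 0)) ξ v v
      = q.derivative.derivative.eval (ξ 0) * (v 0 - inner ℝ ξ v * ξ 0) ^ 2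
        + q.derivative.eval (ξ 0) *
          (3 * ξ 0 * (inner ℝ ξ v) ^ 2 - ξ 0 - 2 * inner ℝ ξ v * v 0) := by
  have hξ0 : ξ ≠ 0 := norm_pos_iff.mp (by rw [hξ]; exact one_pos)
  set f : EuclideanSpace ℝ (Fin (n + 1)) → ℝ := fun x => q.eval (‖x‖⁻¹ * x 0) with hf
  have hfc : ∀ x, x ≠ 0 → ContDiffAt ℝ 2 f x := by
    intro x hx
    have h1 : ContDiffAt ℝ 2 (fun x : EuclideanSpace ℝ (Fin (n + 1)) => ‖x‖⁻¹ * x 0) x := by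
      refine ((contDiffAt_norm ℝ hx).inv (norm_ne_zero_iff.mpr hx)).mul ?_
      exact (EuclideanSpace.proj (𝕜 := ℝ) (0 : Fin (n + 1))).contDiff.contDiffAt
    have h2 : ContDiff ℝ 2 fun t : ℝ => q.eval t := by
      simpa using q.contDiff_aeval (𝕜 := ℝ) 2
    exact h2.contDiffAt.comp x h1
  set c : ℝ → EuclideanSpace ℝ (Fin (n + 1)) := fun t => ξ + t • v with hcdef
  have hc : ∀ t, HasDerivAt c v t := fun t => by
    have := ((hasDerivAt_id t).smul_const v).const_add ξ
    rw [one_smul] at this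
    exact this
  have hc0 : c 0 = ξ := by simp [hcdef]
  have hproj : ∀ t, HasDerivAt (fun s => c s 0) (v 0) t := fun t =>
    (EuclideanSpace.proj (𝕜 := ℝ) (0 : Fin (n + 1))).hasFDerivAt.comp_hasDerivAt t (hc t)
  have hne : ∀ᶠ t in 𝓝 (0 : ℝ), c t ≠ 0 :=
    (hc 0).continuousAt.eventually_ne (by rwa [hc0])
  set s : ℝ → ℝ := fun t => ‖c t‖⁻¹ * c t 0
  set s' : ℝ → ℝ := fun t => -(inner ℝ (c t) v * ‖c t‖⁻¹ ^ 3) * c t 0 + ‖c t‖⁻¹ * v 0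
  have hs : ∀ t, c t ≠ 0 → HasDerivAt s (s' t) t := fun t ht =>
    (hasDerivAt_inv_norm (hc t) ht).mul (hproj t)
  have hfirst : ∀ t, c t ≠ 0 → fderiv ℝ f (c t) v = q.derivative.eval (s t) * s' t := by
    intro t ht
    have h1 : HasDerivAt (fun t => f (c t)) (fderiv ℝ f (c t) v) t :=
      ((hfc _ ht).differentiableAt (by norm_num)).hasFDerivAt.comp_hasDerivAt t (hc t)
    have h2 : HasDerivAt (fun t => f (c t)) (q.derivative.eval (s t) * s' t) t :=
      (q.hasDerivAt (s t)).comp t (hs t ht)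
    exact h1.unique h2
  have hsecond : HasDerivAt (fun t => fderiv ℝ f (c t) v) (fderiv ℝ (fderiv ℝ f) ξ v v) 0 := by
    have hd : DifferentiableAt ℝ (fderiv ℝ f) (c 0) := by
      rw [hc0]
      exact ((hfc ξ hξ0).fderiv_right (m := 1) (by norm_num)).differentiableAt (by norm_num)
    have := hd.hasFDerivAt.comp_hasDerivAt 0 (hc 0)
    rw [hc0] at this
    exact this.clm_apply (hasDerivAt_const 0 v) |>.congr_deriv (by simp)
  have hin : HasDerivAt (fun t => inner ℝ (c t) v) 1 0 := by
    have := (hc 0).inner ℝ (hasDerivAt_const 0 v)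
    refine this.congr_deriv ?_
    simp [hv]
  have hN := hasDerivAt_inv_norm (hc 0) (by rwa [hc0])
  have hs'd := ((hin.mul (hN.pow 3)).neg.mul (hproj 0)).add (hN.mul_const (v 0))
  have hcomp := ((q.derivative.hasDerivAt (s 0)).comp 0 (hs 0 (by rwa [hc0]))).mul hs'd
  have heq : (fun t => fderiv ℝ f (c t) v) =ᶠ[𝓝 0] fun t => q.derivative.eval (s t) * s' t := by
    filter_upwards [hne] with t ht using hfirst t ht
  have hs0 : s 0 = ξ 0 := by simp [s, hc0, hξ]
  have hs'0 : s' 0 = -(inner ℝ ξ v) * ξ 0 + v 0 := by simp [s', hc0, hξ]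
  rw [hsecond.unique (HasDerivAt.congr_of_eventuallyEq hcomp heq)]
  simp [hs0, hs'0, hc0, hξ]
  ring

/-- The Laplace–Beltrami operator on polynomials in the first coordinate. -/
lemma sphLaplacian_polynomial (q : Polynomial ℝ) (ξ : Sph n) :
    sphLaplacian (fun η : Sph n => q.eval ((η : EuclideanSpace ℝ (Fin (n + 1))) 0)) ξ
      = (1 - (ξ : EuclideanSpace ℝ (Fin (n + 1))) 0 ^ 2) * q.derivative.derivative.eval
          ((ξ : EuclideanSpace ℝ (Fin (n + 1))) 0)
        - n * (ξ : EuclideanSpace ℝ (Fin (n + 1))) 0 *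
          q.derivative.eval ((ξ : EuclideanSpace ℝ (Fin (n + 1))) 0) := by
  obtain ⟨x, hx⟩ := ξ
  have hx1 : ‖x‖ = 1 := by simpa using hx
  have hx0 : x ≠ 0 := norm_pos_iff.mp (by rw [hx1]; exact one_pos)
  have hev : radialExt (fun η : Sph n => q.eval ((η : EuclideanSpace ℝ (Fin (n + 1))) 0))
      =ᶠ[𝓝 x] fun y => q.eval (‖y‖⁻¹ * y 0) := by
    filter_upwards [isOpen_ne.mem_nhds hx0] with y hy
    have : y ≠ 0 := hy
    simp [radialExt, this]
  have hsum : ∑ i, x i ^ 2 = 1 := by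
    have := EuclideanSpace.real_norm_sq_eq x
    rw [hx1] at this; linarith
  rw [sphLaplacian, (InnerProductSpace.laplacian_congr_nhds hev).eq_of_nhds,
    InnerProductSpace.laplacian_eq_iteratedFDeriv_orthonormalBasis _
      (EuclideanSpace.basisFun (Fin (n + 1)) ℝ)]
  simp only [iteratedFDeriv_two_apply, Matrix.cons_val_zero, Matrix.cons_val_one]
  have hterm : ∀ i, fderiv ℝ (fderiv ℝ fun y : EuclideanSpace ℝ (Fin (n + 1)) =>
      q.eval (‖y‖⁻¹ * y 0)) x (EuclideanSpace.basisFun (Fin (n + 1)) ℝ i)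
        (EuclideanSpace.basisFun (Fin (n + 1)) ℝ i)
      = q.derivative.derivative.eval (x 0) * ((if i = 0 then 1 else 0) - x i * x 0) ^ 2
        + q.derivative.eval (x 0) *
          (3 * x 0 * x i ^ 2 - x 0 - 2 * x i * (if i = 0 then 1 else 0)) := by
    intro i
    rw [fderiv_fderiv_comp_radial q hx1 (by simp)]
    have hin : inner ℝ x (EuclideanSpace.single i (1 : ℝ)) = x i := by
      simp [EuclideanSpace.inner_single_right]
    simp [eq_comm, hin]
  simp_rw [hterm]
  rw [Finset.sum_add_distrib, ← Finset.mul_sum, ← Finset.mul_sum]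
  have h1 : ∑ i : Fin (n + 1), ((if i = 0 then 1 else 0) - x i * x 0) ^ 2 = 1 - x 0 ^ 2 := by
    have : ∀ i : Fin (n + 1), ((if i = 0 then 1 else 0) - x i * x 0) ^ 2
        = (if i = 0 then 1 - 2 * x i * x 0 else 0) + x i ^ 2 * x 0 ^ 2 := by
      intro i; split_ifs <;> ring
    simp_rw [this]
    rw [Finset.sum_add_distrib, ← Finset.sum_mul, hsum]
    simp; ring
  have h2 : ∑ i : Fin (n + 1), (3 * x 0 * x i ^ 2 - x 0 - 2 * x i * (if i = 0 then 1 else 0))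
      = -(n * x 0) := by
    rw [Finset.sum_sub_distrib, Finset.sum_sub_distrib, ← Finset.mul_sum, hsum]
    simp; ring
  rw [h1, h2]
  ring

/-- The zonal polynomial of degree `k` is an eigenfunction with eigenvalue `k (k + n - 1)`. -/
lemma isEigenfunction_zonal (hn : 2 ≤ n) (k : ℕ) :
    IsEigenfunction (k * (k + n - 1) : ℝ)
      (fun ξ : Sph n => zonal n k ((ξ : EuclideanSpace ℝ (Fin (n + 1))) 0)) := by
  constructor
  · have h1 : ContDiff ℝ ∞ fun x : EuclideanSpace ℝ (Fin (n + 1)) => zonal n k (x 0) := by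
      have h2 : ContDiff ℝ ∞ (zonal n k) := by
        change ContDiff ℝ ∞ fun t => (zonalPoly n k).eval t
        simpa using (zonalPoly n k).contDiff_aeval (𝕜 := ℝ) ∞
      exact h2.comp (EuclideanSpace.proj (𝕜 := ℝ) (0 : Fin (n + 1))).contDiff
    exact h1.contMDiff.comp contMDiff_coe_sphere
  · intro ξ
    have := sphLaplacian_polynomial (zonalPoly n k) ξ
    unfold zonal
    rw [this]
    have h := zonal_ode hn k ((ξ : EuclideanSpace ℝ (Fin (n + 1))) 0)
    simp only [zonal, zonalDeriv] at h
    linear_combination -h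

/-- The symbol of the Paneitz operator at the eigenvalue of degree `k` is `k (k + 1) ⋯ (k + n - 1)`. -/
lemma paneitzSymbol_eigenvalue (hn : 2 ≤ n) (k : ℕ) :
    paneitzSymbol n (k * (k + n - 1)) = ∏ j ∈ Finset.range n, ((k : ℝ) + j) := by
  have hfac : ∀ j : ℕ, ((k : ℝ) * (k + n - 1) + j * (n - j - 1)) = (k + j) * (k + (n - 1 - j)) := by
    intro j; ring
  have hrefl : ∀ m, m ≤ n → ∏ j ∈ Finset.range m, ((k : ℝ) + (n - 1 - j))
      = ∏ j ∈ Finset.Ico (n - m) n, ((k : ℝ) + j) := by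
    intro m
    induction m with
    | zero => simp
    | succ m ih =>
      intro hm
      rw [Finset.prod_range_succ, ih (by omega),
        Finset.prod_eq_prod_Ico_succ_bot (by omega : n - (m + 1) < n),
        show n - (m + 1) + 1 = n - m by omega, Nat.cast_sub hm]
      push_cast; ring
  rw [paneitzSymbol]
  split_ifs with he
  · obtain ⟨m, rfl⟩ := he
    simp_rw [hfac]
    rw [Finset.prod_mul_distrib, hrefl _ (by omega), show (m + m) / 2 = m by omega,
      show m + m - m = m by omega]
    exact Finset.prod_range_mul_prod_Ico _ (by omega)
  · obtain ⟨m, rfl⟩ := Nat.not_even_iff_odd.mp he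
    simp_rw [hfac]
    have hsq : (k : ℝ) * (k + ((2 * m + 1 : ℕ) : ℝ) - 1) + ((((2 * m + 1 : ℕ) : ℝ) - 1) / 2) ^ 2
        = (k + m) ^ 2 := by push_cast; ring
    rw [hsq, Real.sqrt_sq (by positivity), Finset.prod_mul_distrib, hrefl _ (by omega),
      show (2 * m + 1 - 1) / 2 = m by omega, show 2 * m + 1 - m = m + 1 by omega, ← mul_assoc,
      mul_comm ((k : ℝ) + m), ← Finset.prod_range_succ fun j : ℕ => (k : ℝ) + j]
    exact Finset.prod_range_mul_prod_Ico _ (by omega)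

/-! ### The law of the first coordinate on the sphere -/

/-- Integration in polar coordinates. -/
lemma integral_eq_integral_polar (F : EuclideanSpace ℝ (Fin (n + 1)) → ℝ) :
    ∫ x, F x = ∫ p : Sph n × Ioi (0 : ℝ),
      F ((p.2 : ℝ) • (p.1 : EuclideanSpace ℝ (Fin (n + 1)))) ∂((volume : Measure
        (EuclideanSpace ℝ (Fin (n + 1)))).toSphere.prod (Measure.volumeIoiPow n)) := by
  have hdim : Module.finrank ℝ (EuclideanSpace ℝ (Fin (n + 1))) - 1 = n := by simp
  have h := (volume : Measure (EuclideanSpace ℝ (Fin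
    (n + 1)))).measurePreserving_homeomorphUnitSphereProd.integral_comp
    (Homeomorph.measurableEmbedding _)
    (fun p => F ((p.2 : ℝ) • (p.1 : EuclideanSpace ℝ (Fin (n + 1)))))
  rw [hdim] at h
  have h0 : ∫ x, F x = ∫ x : ({(0)}ᶜ : Set (EuclideanSpace ℝ (Fin (n + 1)))),
      F x.1 ∂(volume.comap Subtype.val) := by
    rw [integral_subtype_comap (measurableSet_singleton _).compl F, restrict_compl_singleton]
  rw [h0, ← h]
  refine integral_congr_ae (Eventually.of_forall fun x => ?_)
  have hx : ‖(x : EuclideanSpace ℝ (Fin (n + 1)))‖ ≠ 0 := norm_ne_zero_iff.mpr x.2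
  simp [smul_smul, mul_inv_cancel₀ hx]

/-- The radial Gaussian moments. -/
lemma integral_volumeIoiPow_gaussian (m : ℕ) :
    ∫ r : Ioi (0 : ℝ), (r : ℝ) ^ m * Real.exp (-(r : ℝ) ^ 2) ∂(Measure.volumeIoiPow n)
      = 1 / 2 * Real.Gamma ((n + m + 1) / 2) := by
  have h := integral_rpow_mul_exp_neg_rpow (p := 2) (q := (n : ℝ) + m) (by norm_num)
    (by have : (0 : ℝ) ≤ n + m := by positivity
        linarith)
  rw [← h]
  simp only [Measure.volumeIoiPow, ENNReal.ofReal]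
  rw [integral_withDensity_eq_integral_smul (measurable_subtype_coe.pow_const _).real_toNNReal,
    integral_subtype_comap measurableSet_Ioi fun a : ℝ =>
      Real.toNNReal (a ^ n) • (a ^ m * Real.exp (-a ^ 2))]
  refine setIntegral_congr_fun measurableSet_Ioi fun x hx => ?_
  have hx' : 0 < x := hx
  simp only [NNReal.smul_def, smul_eq_mul]
  rw [Real.coe_toNNReal _ (pow_nonneg hx'.le _), Real.rpow_add hx', Real.rpow_natCast,
    Real.rpow_natCast, Real.rpow_two]
  ring

lemma gaussian_moment_eq (m : ℕ) :
    ∫ x : EuclideanSpace ℝ (Fin (n + 1)), x 0 ^ m * Real.exp (-‖x‖ ^ 2)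
      = (∫ ξ : Sph n, (ξ : EuclideanSpace ℝ (Fin (n + 1))) 0 ^ m
          ∂(volume : Measure (EuclideanSpace ℝ (Fin (n + 1)))).toSphere)
        * (1 / 2 * Real.Gamma ((n + m + 1) / 2)) := by
  rw [integral_eq_integral_polar, ← integral_volumeIoiPow_gaussian, ← integral_prod_mul]
  refine integral_congr_ae (Eventually.of_forall fun p => ?_)
  have hr : (0 : ℝ) < p.2 := p.2.2
  simp [norm_smul, mul_pow, abs_of_pos hr]
  ring

lemma integrable_gaussian_moment (m : ℕ) :
    Integrable fun x : EuclideanSpace ℝ (Fin (n + 1)) => x 0 ^ m * Real.exp (-‖x‖ ^ 2) := by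
  have h : Integrable (fun x : EuclideanSpace ℝ (Fin (n + 1)) =>
      ‖x‖ ^ m * Real.exp (-‖x‖ ^ 2)) := by
    rw [integrable_fun_norm_addHaar volume (f := fun r => r ^ m * Real.exp (-r ^ 2))]
    have := integrableOn_rpow_mul_exp_neg_mul_sq (b := 1) one_pos (s := (n : ℝ) + m)
      (by have : (0 : ℝ) ≤ n + m := by positivity
          linarith)
    refine this.congr_fun (fun x hx => ?_) measurableSet_Ioi
    have hx' : 0 < x := hx
    simp only [finrank_euclideanSpace, Fintype.card_fin, Nat.add_sub_cancel, smul_eq_mul]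
    rw [Real.rpow_add hx', Real.rpow_natCast, Real.rpow_natCast]
    ring_nf
  refine h.mono' (by
    have : Continuous fun x : EuclideanSpace ℝ (Fin (n + 1)) => x 0 :=
      (EuclideanSpace.proj (𝕜 := ℝ) (0 : Fin (n + 1))).continuous
    exact Continuous.aestronglyMeasurable (by fun_prop)) (Eventually.of_forall fun x => ?_)
  rw [norm_mul, norm_pow, Real.norm_of_nonneg (Real.exp_pos _).le]
  gcongr
  exact PiLp.norm_apply_le x 0

/-- Integration by parts for Gaussian moments. -/
lemma gaussian_moment_rec (m : ℕ) :
    2 * ∫ x : EuclideanSpace ℝ (Fin (n + 1)), x 0 ^ (m + 2) * Real.exp (-‖x‖ ^ 2)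
      = (m + 1) * ∫ x : EuclideanSpace ℝ (Fin (n + 1)), x 0 ^ m * Real.exp (-‖x‖ ^ 2) := by
  set e : EuclideanSpace ℝ (Fin (n + 1)) := EuclideanSpace.single 0 1
  have hp : ∀ x : EuclideanSpace ℝ (Fin (n + 1)), HasFDerivAt
      (fun x : EuclideanSpace ℝ (Fin (n + 1)) => x 0)
      (EuclideanSpace.proj (𝕜 := ℝ) (0 : Fin (n + 1))) x :=
    fun x => (EuclideanSpace.proj (𝕜 := ℝ) (0 : Fin (n + 1))).hasFDerivAt
  have hf : ∀ x : EuclideanSpace ℝ (Fin (n + 1)),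
      HasLineDerivAt ℝ (fun x : EuclideanSpace ℝ (Fin (n + 1)) => x 0 ^ (m + 1))
        ((m + 1) * x 0 ^ m) x e := by
    intro x
    have := ((hp x).pow (m + 1)).hasLineDerivAt e
    convert! this using 1
    simp [e]
  have hg : ∀ x : EuclideanSpace ℝ (Fin (n + 1)),
      HasLineDerivAt ℝ (fun x : EuclideanSpace ℝ (Fin (n + 1)) => Real.exp (-‖x‖ ^ 2))
        (-(2 * x 0) * Real.exp (-‖x‖ ^ 2)) x e := by
    intro x
    have h1 := (((hasStrictFDerivAt_norm_sq x).hasFDerivAt).neg.exp).hasLineDerivAt e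
    convert! h1 using 1
    have hin : inner ℝ x e = x 0 := by
      simp [e, EuclideanSpace.inner_single_right]
    simp [hin]
    ring
  have hI := integrable_gaussian_moment (n := n)
  have hm1 : Integrable fun x : EuclideanSpace ℝ (Fin (n + 1)) =>
      (m + 1) * x 0 ^ m * Real.exp (-‖x‖ ^ 2) := by
    refine ((hI m).const_mul (m + 1)).congr (Eventually.of_forall fun x => ?_)
    simp only; ring
  have hm2 : Integrable fun x : EuclideanSpace ℝ (Fin (n + 1)) =>
      x 0 ^ (m + 1) * (-(2 * x 0) * Real.exp (-‖x‖ ^ 2)) := by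
    refine ((hI (m + 2)).const_mul (-2)).congr (Eventually.of_forall fun x => ?_)
    simp only; ring
  have key := integral_bilinear_hasLineDerivAt_right_eq_neg_left_of_integrable
    (μ := (volume : Measure (EuclideanSpace ℝ (Fin (n + 1)))))
    (B := ContinuousLinearMap.mul ℝ ℝ) (v := e) (by simpa using hm1) (by simpa using hm2)
    (by simpa using hI (m + 1)) (fun x _ => hf x) (fun x _ => hg x)
  simp only [ContinuousLinearMap.mul_apply'] at key
  have h1 : ∫ x : EuclideanSpace ℝ (Fin (n + 1)),
      x 0 ^ (m + 1) * (-(2 * x 0) * Real.exp (-‖x‖ ^ 2))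
      = -2 * ∫ x : EuclideanSpace ℝ (Fin (n + 1)), x 0 ^ (m + 2) * Real.exp (-‖x‖ ^ 2) := by
    rw [← integral_const_mul]; congr 1; ext x; ring
  have h2 : ∫ x : EuclideanSpace ℝ (Fin (n + 1)), (m + 1) * x 0 ^ m * Real.exp (-‖x‖ ^ 2)
      = (m + 1) * ∫ x : EuclideanSpace ℝ (Fin (n + 1)), x 0 ^ m * Real.exp (-‖x‖ ^ 2) := by
    rw [← integral_const_mul]; congr 1; ext x; ring
  rw [h1, h2] at key
  linarith

lemma integral_sphMeasure (f : Sph n → ℝ) : ∫ ξ, f ξ ∂(sphMeasure n) =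
    ((volume : Measure (EuclideanSpace ℝ (Fin (n + 1)))).toSphere univ)⁻¹.toReal *
      ∫ ξ, f ξ ∂(volume : Measure (EuclideanSpace ℝ (Fin (n + 1)))).toSphere := by
  rw [sphMeasure, integral_smul_measure, smul_eq_mul]

/-- The recurrence for the moments of the first coordinate on the sphere. -/
lemma sph_moment_rec (m : ℕ) :
    (m + n + 1) * ∫ ξ, (ξ : EuclideanSpace ℝ (Fin (n + 1))) 0 ^ (m + 2) ∂(sphMeasure n)
      = (m + 1) * ∫ ξ, (ξ : EuclideanSpace ℝ (Fin (n + 1))) 0 ^ m ∂(sphMeasure n) := by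
  have h := gaussian_moment_rec (n := n) m
  rw [gaussian_moment_eq, gaussian_moment_eq] at h
  have hs : (0 : ℝ) < (n + m + 1) / 2 := by positivity
  have hG := Real.Gamma_add_one hs.ne'
  have hG0 := Real.Gamma_pos_of_pos hs
  have he : ((n : ℝ) + (m + 2 : ℕ) + 1) / 2 = (n + m + 1) / 2 + 1 := by push_cast; ring
  rw [he, hG] at h
  rw [integral_sphMeasure, integral_sphMeasure]
  apply mul_left_cancel₀ hG0.ne'
  linear_combination
    2 * ((volume : Measure (EuclideanSpace ℝ (Fin (n + 1)))).toSphere univ)⁻¹.toReal * h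

lemma sph_moment_one :
    ∫ ξ, (ξ : EuclideanSpace ℝ (Fin (n + 1))) 0 ∂(sphMeasure n) = 0 := by
  have h := gaussian_moment_eq (n := n) 1
  have hneg := integral_neg_eq_self (fun x : EuclideanSpace ℝ (Fin (n + 1)) =>
    x 0 ^ 1 * Real.exp (-‖x‖ ^ 2)) volume
  have h0 : ∫ x : EuclideanSpace ℝ (Fin (n + 1)), x 0 ^ 1 * Real.exp (-‖x‖ ^ 2) = 0 := by
    simp only [norm_neg, PiLp.neg_apply, pow_one, neg_mul, integral_neg] at hneg ⊢
    linarith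
  rw [h0] at h
  have hG0 : 0 < Real.Gamma ((n + (1 : ℕ) + 1) / 2) := Real.Gamma_pos_of_pos (by positivity)
  have h2 := (mul_eq_zero.mp h.symm).resolve_right (by positivity)
  simp only [pow_one] at h2
  rw [integral_sphMeasure, h2, mul_zero]

lemma zonal_moment_rec (hn : 2 ≤ n) (m : ℕ) :
    (m + n + 1) * ∫ x, x ^ (m + 2) ∂(zonalMeasure n)
      = (m + 1) * ∫ x, x ^ m ∂(zonalMeasure n) := by
  have h := integral_divergence_of_continuous hn (F := fun x => x ^ (m + 1))
    (F' := fun x => (m + 1) * x ^ m)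
    (fun x => by simpa using hasDerivAt_pow (m + 1) x) (by fun_prop)
  have he : ∀ x : ℝ, (1 - x ^ 2) * ((m + 1) * x ^ m) - n * x * x ^ (m + 1)
      = (m + 1) * x ^ m - (m + n + 1) * x ^ (m + 2) := fun x => by ring
  simp_rw [he] at h
  rw [integral_sub (integrable_of_continuous hn (by fun_prop))
    (integrable_of_continuous hn (by fun_prop)), integral_const_mul, integral_const_mul] at h
  linarith

lemma measurable_coord : Measurable fun ξ : Sph n => (ξ : EuclideanSpace ℝ (Fin (n + 1))) 0 :=
  ((EuclideanSpace.proj (𝕜 := ℝ) (0 : Fin (n + 1))).continuous.comp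
    continuous_subtype_val).measurable

lemma coord_mem_Icc (ξ : Sph n) : (ξ : EuclideanSpace ℝ (Fin (n + 1))) 0 ∈ Icc (-1 : ℝ) 1 := by
  have h := PiLp.norm_apply_le (ξ : EuclideanSpace ℝ (Fin (n + 1))) 0
  have h1 : ‖(ξ : EuclideanSpace ℝ (Fin (n + 1)))‖ = 1 := by simp
  rw [h1, Real.norm_eq_abs] at h
  exact abs_le.mp h

lemma moments_eq (hn : 2 ≤ n) (m : ℕ) :
    ∫ ξ, (ξ : EuclideanSpace ℝ (Fin (n + 1))) 0 ^ m ∂(sphMeasure n)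
      = ∫ x, x ^ m ∂(zonalMeasure n) := by
  have := isProbabilityMeasure_zonalMeasure hn
  induction m using Nat.strong_induction_on with
  | _ m ih =>
    match m, ih with
    | 0, _ => simp
    | 1, _ =>
      have h := integral_zonal_mul_of_ne hn zero_ne_one
      simp only [zonal_zero, zonal_one, one_mul] at h
      simp only [pow_one]
      rw [sph_moment_one, h]
    | m + 2, ih =>
      have h1 := sph_moment_rec (n := n) m
      have h2 := zonal_moment_rec hn m
      rw [ih m (by omega), ← h2] at h1
      exact mul_left_cancel₀ (by positivity) h1

/-- Two finite measures on `[-1, 1]` with the same moments coincide. -/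
lemma measure_ext_of_moments {μ ν : Measure ℝ} [IsFiniteMeasure μ] [IsFiniteMeasure ν]
    (hμ : ∀ᵐ x ∂μ, x ∈ Icc (-1 : ℝ) 1) (hν : ∀ᵐ x ∂ν, x ∈ Icc (-1 : ℝ) 1)
    (h : ∀ m : ℕ, ∫ x, x ^ m ∂μ = ∫ x, x ^ m ∂ν) : μ = ν := by
  have hi : ∀ (ρ : Measure ℝ) [IsFiniteMeasure ρ], (∀ᵐ x ∂ρ, x ∈ Icc (-1 : ℝ) 1) →
      ∀ q : ℝ → ℝ, Continuous q → Integrable q ρ := by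
    intro ρ _ hρ q hq
    obtain ⟨C, hC⟩ := (isCompact_Icc (a := (-1 : ℝ)) (b := 1)).exists_bound_of_continuousOn
      hq.continuousOn
    refine Integrable.of_bound hq.aestronglyMeasurable C ?_
    filter_upwards [hρ] with x hx using hC x hx
  have hpoly : ∀ q : Polynomial ℝ, ∫ x, q.eval x ∂μ = ∫ x, q.eval x ∂ν := by
    intro q
    induction q using Polynomial.induction_on' with
    | add p q hp hq =>
      simp_rw [Polynomial.eval_add]
      rw [integral_add (hi μ hμ _ p.continuous) (hi μ hμ _ q.continuous),
        integral_add (hi ν hν _ p.continuous) (hi ν hν _ q.continuous), hp, hq]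
    | monomial m a =>
      simp_rw [Polynomial.eval_monomial]
      rw [integral_const_mul, integral_const_mul, h]
  refine ext_of_forall_integral_eq_of_IsFiniteMeasure fun g => ?_
  have hgc := g.continuous
  have hclose : ∀ (ρ : Measure ℝ) [IsFiniteMeasure ρ], (∀ᵐ x ∂ρ, x ∈ Icc (-1 : ℝ) 1) →
      ∀ ε (p : Polynomial ℝ), (∀ x ∈ Icc (-1 : ℝ) 1, |p.eval x - g x| < ε) →
      |∫ x, p.eval x ∂ρ - ∫ x, g x ∂ρ| ≤ ε * ρ.real univ := by
    intro ρ _ hρ ε p hp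
    rw [← integral_sub (hi ρ hρ _ p.continuous) (hi ρ hρ _ hgc)]
    refine norm_integral_le_of_norm_le_const (μ := ρ) (f := fun x => p.eval x - g x) ?_
    filter_upwards [hρ] with x hx using (hp x hx).le
  by_contra hne
  have hpos := abs_pos.mpr (sub_ne_zero.mpr hne)
  set d := |∫ x, g x ∂μ - ∫ x, g x ∂ν|
  set M := μ.real univ + ν.real univ
  have hM : 0 ≤ M := by positivity
  obtain ⟨p, hp⟩ := exists_polynomial_near_of_continuousOn (-1) 1 g hgc.continuousOn
    (d / (2 * (1 + M))) (by positivity)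
  have h1 := hclose μ hμ _ p hp
  have h2 := hclose ν hν _ p hp
  rw [hpoly p] at h1
  have h3 : d ≤ d / (2 * (1 + M)) * M := by
    calc d = |(∫ x, p.eval x ∂ν - ∫ x, g x ∂ν) - (∫ x, p.eval x ∂ν - ∫ x, g x ∂μ)| := by
          simp only [d]; congr 1; ring
      _ ≤ _ := abs_sub _ _
      _ ≤ _ := by simp only [M]; linarith
  rw [div_mul_eq_mul_div, le_div_iff₀ (by positivity)] at h3
  nlinarith

/-- The law of the first coordinate on the sphere. -/
lemma map_coord_sphMeasure (hn : 2 ≤ n) :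
    (sphMeasure n).map (fun ξ : Sph n => (ξ : EuclideanSpace ℝ (Fin (n + 1))) 0)
      = zonalMeasure n := by
  have := isProbabilityMeasure_zonalMeasure hn
  have := Measure.isProbabilityMeasure_map (μ := sphMeasure n)
    (measurable_coord (n := n)).aemeasurable
  refine measure_ext_of_moments ?_ ?_ fun m => ?_
  · exact (ae_map_iff measurable_coord.aemeasurable measurableSet_Icc).mpr
      (Eventually.of_forall coord_mem_Icc)
  · filter_upwards [ae_zonalMeasure_mem n] with x hx using Ioo_subset_Icc_self hx
  · rw [integral_map measurable_coord.aemeasurable (by fun_prop), moments_eq hn]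

/-! ### Zonal coefficients and logarithmic bounds for potentials -/

lemma one_le_rpow_neg {x s : ℝ} (hx : x ∈ Ioo (-1 : ℝ) 1) (hs : 0 ≤ s) :
    1 ≤ (1 - x ^ 2) ^ (-s) :=
  Real.one_le_rpow_of_pos_of_le_one_of_nonpos (one_sub_sq_pos hx) (one_sub_sq_le_one x)
    (by linarith)

/-- The zonal polynomials decay as the degree grows, at a rate that deteriorates
only mildly at the poles. -/
lemma exists_abs_zonal_le (hn : 2 ≤ n) : ∃ D δ : ℝ, 1 ≤ D ∧ 0 < δ ∧
    ∀ k, ∀ x ∈ Ioo (-1 : ℝ) 1,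
      |zonal n k x| ≤ D * (1 - x ^ 2) ^ (-(1 / 8) : ℝ) * ((k : ℝ) + 1) ^ (-δ) := by
  obtain ⟨C, hC, h⟩ := exists_sq_zonal_le hn
  have hn' : (2 : ℝ) ≤ n := by exact_mod_cast hn
  have hδ : (0 : ℝ) < 1 / (4 * n) := by positivity
  -- the bound `R² ≤ C (1 - x²) ^ (-n / 2) / (k + 1)`, raised to a small power since `|R| ≤ 1`
  refine ⟨(max C 1) ^ (1 / (4 * n) : ℝ), 1 / (4 * n),
    Real.one_le_rpow (le_max_right _ _) hδ.le, hδ, fun k x hx => ?_⟩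
  have hy := one_sub_sq_pos hx
  rcases Nat.eq_zero_or_pos k with rfl | hk
  · simp only [zonal_zero, abs_one, Nat.cast_zero, zero_add, Real.one_rpow, mul_one]
    exact one_le_mul_of_one_le_of_one_le (Real.one_le_rpow (le_max_right _ _) hδ.le)
      (one_le_rpow_neg hx (by norm_num))
  have h1 := abs_zonal_le_one hn k (x := x) (by linarith)
  have h2 : zonal n k x ^ 2 ≤ max C 1 * (1 - x ^ 2) ^ (-((n : ℝ) / 2)) * ((k : ℝ) + 1)⁻¹ := by
    have h3 := h k hk x hx
    have h4 := zonalNormSq_le hn k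
    rw [Real.rpow_neg hy.le, mul_right_comm, ← div_eq_mul_inv, le_div_iff₀ (by positivity),
      mul_comm]
    refine h3.trans ?_
    rw [one_div] at h4
    have := zonalNormSq_nonneg n k
    gcongr
    exact le_max_left _ _
  calc |zonal n k x| = (|zonal n k x|) ^ (1 : ℝ) := (Real.rpow_one _).symm
    _ ≤ |zonal n k x| ^ (2 * (1 / (4 * n)) : ℝ) := by
      refine Real.rpow_le_rpow_of_exponent_ge_of_imp (abs_nonneg _) h1 ?_ (by simp)
      rw [mul_one_div, div_le_one (by positivity)]; linarith
    _ = (zonal n k x ^ 2) ^ (1 / (4 * n) : ℝ) := by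
      rw [Real.rpow_mul (abs_nonneg _), Real.rpow_two, sq_abs]
    _ ≤ (max C 1 * (1 - x ^ 2) ^ (-((n : ℝ) / 2)) * ((k : ℝ) + 1)⁻¹) ^ (1 / (4 * n) : ℝ) :=
      Real.rpow_le_rpow (sq_nonneg _) h2 hδ.le
    _ = _ := by
      rw [Real.mul_rpow (by positivity) (by positivity), Real.mul_rpow (by positivity)
        (by positivity), ← Real.rpow_mul hy.le, Real.inv_rpow (by positivity),
        ← Real.rpow_neg (by positivity)]
      congr 3
      field_simp
      norm_num

lemma integrable_of_abs_le_rpow (hn : 2 ≤ n) {h : ℝ → ℝ}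
    (hm : AEStronglyMeasurable h (zonalMeasure n)) {K s : ℝ} (hs : s ≤ 1 / 2)
    (hb : ∀ x ∈ Ioo (-1 : ℝ) 1, |h x| ≤ K * (1 - x ^ 2) ^ (-s)) : Integrable h (zonalMeasure n) := by
  have hm0 := zonalMass_pos hn
  have hK : 0 ≤ K := by
    have := (abs_nonneg _).trans (hb 0 (by norm_num))
    simpa using this
  have hbase : IntegrableOn (fun x : ℝ => (1 - x) ^ (-(1 / 2) : ℝ) + (1 + x) ^ (-(1 / 2) : ℝ))
      (Ioo (-1) 1) := by
    rw [← intervalIntegrable_iff_integrableOn_Ioo_of_le (by norm_num)]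
    have h0 : IntervalIntegrable (fun x : ℝ => x ^ (-(1 / 2) : ℝ)) volume 0 2 :=
      intervalIntegral.intervalIntegrable_rpow' (by norm_num)
    have h1 : IntervalIntegrable (fun x : ℝ => (1 - x) ^ (-(1 / 2) : ℝ)) volume (-1) 1 := by
      have := (h0.comp_sub_left 1).symm
      norm_num at this ⊢
      exact this
    have h2 : IntervalIntegrable (fun x : ℝ => (1 + x) ^ (-(1 / 2) : ℝ)) volume (-1) 1 := by
      have := h0.comp_add_left 1
      norm_num at this ⊢
      exact this
    exact h1.add h2
  have hdom : Integrable (fun x : ℝ => K * (1 - x ^ 2) ^ (-s)) (zonalMeasure n) := by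
    rw [integrable_zonalMeasure_iff hn]
    refine (hbase.const_mul ((zonalMass n)⁻¹ * K)).mono' ?_ ?_
    · exact (by unfold zonalWeight; fun_prop : Measurable fun x : ℝ =>
        (zonalMass n)⁻¹ * zonalWeight n x * (K * (1 - x ^ 2) ^ (-s))).aestronglyMeasurable
    · filter_upwards [ae_restrict_mem measurableSet_Ioo] with x hx
      have hy := one_sub_sq_pos hx
      have hw := zonalWeight_pos (n := n) hx
      rw [Real.norm_of_nonneg (by positivity)]
      have h1 : (1 - x ^ 2) ^ (-s) ≤ (1 - x ^ 2) ^ (-(1 / 2) : ℝ) :=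
        Real.rpow_le_rpow_of_exponent_ge hy (one_sub_sq_le_one x) (by linarith)
      have h1x : 0 < 1 - x := by linarith [hx.2]
      have h2x : 0 < 1 + x := by linarith [hx.1]
      have h2 : (1 - x ^ 2) ^ (-(1 / 2) : ℝ)
          ≤ (1 - x) ^ (-(1 / 2) : ℝ) + (1 + x) ^ (-(1 / 2) : ℝ) := by
        rcases le_total 0 x with h0 | h0
        · have : (1 - x ^ 2) ^ (-(1 / 2) : ℝ) ≤ (1 - x) ^ (-(1 / 2) : ℝ) :=
            Real.rpow_le_rpow_of_nonpos h1x (by nlinarith) (by norm_num)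
          have : 0 ≤ (1 + x) ^ (-(1 / 2) : ℝ) := by positivity
          linarith
        · have : (1 - x ^ 2) ^ (-(1 / 2) : ℝ) ≤ (1 + x) ^ (-(1 / 2) : ℝ) :=
            Real.rpow_le_rpow_of_nonpos h2x (by nlinarith) (by norm_num)
          have : 0 ≤ (1 - x) ^ (-(1 / 2) : ℝ) := by positivity
          linarith
      calc (zonalMass n)⁻¹ * zonalWeight n x * (K * (1 - x ^ 2) ^ (-s))
          ≤ (zonalMass n)⁻¹ * 1 * (K * ((1 - x) ^ (-(1 / 2) : ℝ) + (1 + x) ^ (-(1 / 2) : ℝ))) := by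
            gcongr
            · exact zonalWeight_le_one hn hx
            · exact h1.trans h2
        _ = _ := by ring
  refine hdom.mono' hm ?_
  filter_upwards [ae_zonalMeasure_mem n] with x hx using hb x hx

/-- The coefficients of a function against the zonal polynomials. -/
noncomputable def zonalCoeff (n : ℕ) (v : ℝ → ℝ) (k : ℕ) : ℝ :=
  ∫ x, v x * zonal n k x ∂(zonalMeasure n)

lemma integrable_mul_zonal (hn : 2 ≤ n) {v : ℝ → ℝ} (hv : Integrable v (zonalMeasure n)) (k : ℕ) :
    Integrable (fun x => v x * zonal n k x) (zonalMeasure n) := by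
  refine hv.mul_bdd (c := 1) (continuous_zonal n k).aestronglyMeasurable ?_
  filter_upwards [ae_zonalMeasure_mem n] with x hx
  exact abs_zonal_le_one hn k (by linarith [one_sub_sq_pos hx])

/-- A Riemann–Lebesgue lemma for zonal coefficients. -/
lemma tendsto_zonalCoeff (hn : 2 ≤ n) {v : ℝ → ℝ} (hv : Integrable v (zonalMeasure n)) :
    Tendsto (zonalCoeff n v) atTop (𝓝 0) := by
  obtain ⟨D, δ, hD, hδ, h⟩ := exists_abs_zonal_le hn
  have h0 : (0 : ℝ) = ∫ x, (0 : ℝ) ∂(zonalMeasure n) := by simp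
  rw [h0]
  refine tendsto_integral_of_dominated_convergence (fun x => |v x|)
    (fun k => (integrable_mul_zonal hn hv k).aestronglyMeasurable) hv.abs (fun k => ?_) ?_
  · filter_upwards [ae_zonalMeasure_mem n] with x hx
    have h1 := abs_zonal_le_one hn k (x := x) (by linarith [one_sub_sq_pos hx])
    rw [norm_mul, Real.norm_eq_abs, Real.norm_eq_abs]
    exact mul_le_of_le_one_right (abs_nonneg _) h1
  · filter_upwards [ae_zonalMeasure_mem n] with x hx
    have hlim : Tendsto (fun k : ℕ => D * (1 - x ^ 2) ^ (-(1 / 8) : ℝ) * ((k : ℝ) + 1) ^ (-δ))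
        atTop (𝓝 0) := by
      have h1 : Tendsto (fun k : ℕ => (k : ℝ) + 1) atTop atTop :=
        tendsto_atTop_add_const_right _ _ tendsto_natCast_atTop_atTop
      simpa using ((tendsto_rpow_neg_atTop hδ).comp h1).const_mul
        (D * (1 - x ^ 2) ^ (-(1 / 8) : ℝ))
    have hz : Tendsto (fun k => zonal n k x) atTop (𝓝 0) :=
      squeeze_zero_norm (fun k => h k x hx) hlim
    simpa using hz.const_mul (v x)

lemma summable_rpow_succ {s : ℝ} (hs : 1 < s) : Summable fun k : ℕ => ((k : ℝ) + 1) ^ (-s) := by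
  have := (summable_nat_add_iff 1).mpr (Real.summable_nat_rpow.mpr (by linarith : -s < -1))
  simpa using this

/-- A series `∑ r_k / (k + 1)` with `r_k ≤ min 1 (B / (k + 1)^δ)` grows only logarithmically
in `B`: the terms with `k ≤ B^(2/δ)` contribute a harmonic sum. -/
lemma exists_tsum_div_le {δ : ℝ} (hδ : 0 < δ) : ∃ K : ℝ, ∀ B : ℝ, 1 ≤ B → ∀ r : ℕ → ℝ,
    (∀ k, 0 ≤ r k) → (∀ k, r k ≤ 1) → (∀ k, r k ≤ B * ((k : ℝ) + 1) ^ (-δ)) →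
    Summable (fun k => r k / (k + 1)) ∧ ∑' k, r k / (k + 1) ≤ K + 2 / δ * Real.log B := by
  have hs : Summable fun k : ℕ => ((k : ℝ) + 1) ^ (-(1 + δ / 2)) :=
    summable_rpow_succ (by linarith)
  refine ⟨1 + Real.log 2 + ∑' k : ℕ, ((k : ℝ) + 1) ^ (-(1 + δ / 2)),
    fun B hB r h0 h1 hr => ?_⟩
  have hB0 : 0 < B := by linarith
  set N : ℕ := ⌈B ^ (2 / δ)⌉₊
  have hBpow : 1 ≤ B ^ (2 / δ) := Real.one_le_rpow hB (by positivity)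
  have hNlow : B ^ (2 / δ) ≤ N := Nat.le_ceil _
  have hNup : (N : ℝ) ≤ 2 * B ^ (2 / δ) := by
    have := Nat.ceil_lt_add_one (zero_le_one.trans hBpow)
    linarith
  set a : ℕ → ℝ := fun k => if k ∈ Finset.range N then 1 / ((k : ℝ) + 1) else 0
  have ha : HasSum a (∑ k ∈ Finset.range N, 1 / ((k : ℝ) + 1)) := by
    have h2 : ∑ k ∈ Finset.range N, 1 / ((k : ℝ) + 1) = ∑ k ∈ Finset.range N, a k :=
      Finset.sum_congr rfl fun k hk => by simp only [a]; rw [if_pos hk]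
    rw [h2]
    exact hasSum_sum_of_ne_finset_zero fun k hk => by simp only [a]; rw [if_neg hk]
  have hle : ∀ k, r k / (k + 1) ≤ a k + ((k : ℝ) + 1) ^ (-(1 + δ / 2)) := by
    intro k
    have hk : (0 : ℝ) < k + 1 := by positivity
    have hp : 0 ≤ ((k : ℝ) + 1) ^ (-(1 + δ / 2)) := by positivity
    by_cases hkN : k ∈ Finset.range N
    · simp only [a]
      rw [if_pos hkN]
      have : r k / (k + 1) ≤ 1 / (k + 1) := by gcongr; exact h1 k
      linarith
    · simp only [a]
      rw [if_neg hkN, zero_add]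
      have hkN' : N ≤ k := by simpa using hkN
      have h2 : B ^ (2 / δ) ≤ k + 1 := by
        have : (N : ℝ) ≤ k := by exact_mod_cast hkN'
        linarith
      have h3 : B ≤ ((k : ℝ) + 1) ^ (δ / 2) := by
        have := Real.rpow_le_rpow (by positivity) h2 (by positivity : 0 ≤ δ / 2)
        rwa [← Real.rpow_mul hB0.le, show 2 / δ * (δ / 2) = 1 by field_simp,
          Real.rpow_one] at this
      have h4 : r k ≤ ((k : ℝ) + 1) ^ (-(δ / 2)) := by
        refine (hr k).trans ?_
        calc B * ((k : ℝ) + 1) ^ (-δ) ≤ ((k : ℝ) + 1) ^ (δ / 2) * ((k : ℝ) + 1) ^ (-δ) := by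
              gcongr
          _ = _ := by rw [← Real.rpow_add hk]; ring_nf
      calc r k / (k + 1) ≤ ((k : ℝ) + 1) ^ (-(δ / 2)) / (k + 1) := by gcongr
        _ = _ := by
          rw [← Real.rpow_sub_one hk.ne']; ring_nf
  have hsum := ha.summable.add hs
  have hS : Summable (fun k => r k / (k + 1)) :=
    Summable.of_nonneg_of_le (fun k => div_nonneg (h0 k) (by positivity)) hle hsum
  refine ⟨hS, (hS.tsum_le_tsum hle hsum).trans ?_⟩
  rw [ha.summable.tsum_add hs, ha.tsum_eq]
  have hharm : ∑ k ∈ Finset.range N, 1 / ((k : ℝ) + 1) ≤ 1 + Real.log N := by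
    have := harmonic_le_one_add_log N
    simpa [harmonic] using this
  have hlog : Real.log N ≤ Real.log 2 + 2 / δ * Real.log B := by
    rw [← Real.log_rpow hB0, ← Real.log_mul (by norm_num) (by positivity)]
    exact Real.log_le_log (by linarith) hNup
  linarith

/-- The reciprocal of the product of the Paneitz eigenvalue and of the squared norm of the zonal
polynomial of degree `k` (see `greenCoeff_mul`), for `k ≥ 1`: the coefficient of degree `k` in the
zonal expansion of the Green function of the Paneitz operator. -/
noncomputable def greenCoeff (n k : ℕ) : ℝ :=
  (2 * k + n - 1) / (k * (k + n - 1) * (n - 1).factorial)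

lemma greenCoeff_nonneg (hn : 2 ≤ n) {k : ℕ} (hk : 1 ≤ k) : 0 ≤ greenCoeff n k := by
  have h1 := eigenvalue_pos hn hk
  have h2 : (2 : ℝ) ≤ n := by exact_mod_cast hn
  have h3 : (0 : ℝ) ≤ 2 * k + n - 1 := by
    have : (0 : ℝ) ≤ k := by positivity
    linarith
  unfold greenCoeff
  positivity

lemma greenCoeff_le (hn : 2 ≤ n) {k : ℕ} (hk : 1 ≤ k) : greenCoeff n k ≤ 2 / k := by
  have h2 : (2 : ℝ) ≤ n := by exact_mod_cast hn
  have hk' : (1 : ℝ) ≤ k := by exact_mod_cast hk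
  have h3 : (0 : ℝ) < k + n - 1 := by linarith
  have h4 : (1 : ℝ) ≤ (n - 1).factorial := by exact_mod_cast Nat.factorial_pos _
  rw [greenCoeff, div_le_div_iff₀ (by positivity) (by positivity)]
  have h5 : (2 * k + n - 1 : ℝ) ≤ 2 * (k + n - 1) * 1 := by linarith
  calc (2 * k + n - 1 : ℝ) * k ≤ 2 * (k + n - 1) * (n - 1).factorial * k := by
        gcongr
        exact h5.trans (by gcongr)
    _ = _ := by ring

lemma factorial_eq_mul_pred (hn : 2 ≤ n) : (n.factorial : ℝ) = n * (n - 1).factorial := by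
  rw [← Nat.mul_factorial_pred (by omega : n ≠ 0)]; push_cast; ring

/-- The squared norm of a zonal polynomial in terms of the Paneitz eigenvalue. -/
lemma zonalNormSq_mul_prod (hn : 2 ≤ n) {k : ℕ} (hk : 1 ≤ k) :
    zonalNormSq n k * (∏ j ∈ Finset.range n, ((k : ℝ) + j)) * (2 * k + n - 1)
      = (n - 1).factorial * (k * (k + n - 1)) := by
  have h2 : (2 : ℝ) ≤ n := by exact_mod_cast hn
  induction k, hk using Nat.le_induction with
  | base =>
    have h1 := zonalNormSq_succ hn 0
    rw [zonalNormSq_zero hn] at h1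
    have h3 : ∏ j ∈ Finset.range n, (((1 : ℕ) : ℝ) + j) = n.factorial := by
      rw [← Finset.prod_range_add_one_eq_factorial]; push_cast
      exact Finset.prod_congr rfl fun j _ => add_comm _ _
    rw [h3, factorial_eq_mul_pred hn]
    have h4 : ((n : ℝ) - 1) ≠ 0 := by intro h; linarith
    have h5 : zonalNormSq n 1 * (n + 1) = 1 := by
      apply mul_left_cancel₀ h4
      push_cast at h1; linear_combination h1
    push_cast
    linear_combination (n * (n - 1).factorial : ℝ) * h5
  | succ k hk ih =>
    have hk' : (1 : ℝ) ≤ k := by exact_mod_cast hk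
    have hstep : (∏ j ∈ Finset.range n, (((k + 1 : ℕ) : ℝ) + j)) * k
        = (∏ j ∈ Finset.range n, ((k : ℝ) + j)) * (k + n) := by
      rw [← Finset.prod_range_succ, Finset.prod_range_succ']
      push_cast
      rw [add_zero]
      congr 1
      exact Finset.prod_congr rfl fun j _ => by ring
    have hN := zonalNormSq_succ hn k
    have hne : ((2 * k + n - 1) * (k + n - 1) * k : ℝ) ≠ 0 := by
      have : (0 : ℝ) < 2 * k + n - 1 := by linarith
      have : (0 : ℝ) < k + n - 1 := by linarith
      positivity
    apply mul_left_cancel₀ hne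
    push_cast at hstep ⊢
    set P := ∏ j ∈ Finset.range n, ((k : ℝ) + j)
    set P' := ∏ j ∈ Finset.range n, ((k : ℝ) + 1 + j)
    linear_combination (2 * k + n - 1) * (k * P') * hN
      + (2 * k + n - 1) * ((2 * k + n - 1) * (k + 1) * zonalNormSq n k) * hstep
      + (2 * k + n - 1) * (k + 1) * (k + n) * ih

lemma greenCoeff_mul (hn : 2 ≤ n) {k : ℕ} (hk : 1 ≤ k) :
    greenCoeff n k * (∏ j ∈ Finset.range n, ((k : ℝ) + j)) * zonalNormSq n k = 1 := by
  have h := zonalNormSq_mul_prod hn hk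
  have h1 := eigenvalue_pos hn hk
  have h2 : ((n - 1).factorial : ℝ) ≠ 0 := by positivity
  rw [greenCoeff, div_mul_eq_mul_div, div_mul_eq_mul_div, div_eq_one_iff_eq (by positivity)]
  linear_combination h

/-- The function with vanishing mean that the Paneitz operator maps to the function with
coefficients `c`. -/
noncomputable def zonalPotential (n : ℕ) (c : ℕ → ℝ) (x : ℝ) : ℝ :=
  ∑' k, greenCoeff n (k + 1) * c (k + 1) * zonal n (k + 1) x

lemma abs_potential_term_le (hn : 2 ≤ n) (c : ℕ → ℝ) (k : ℕ) (x : ℝ) :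
    |greenCoeff n (k + 1) * c (k + 1) * zonal n (k + 1) x|
      ≤ 2 * |c (k + 1)| * (|zonal n (k + 1) x| / (k + 1)) := by
  have h1 := greenCoeff_nonneg hn (Nat.le_add_left 1 k)
  have h2 := greenCoeff_le hn (Nat.le_add_left 1 k)
  push_cast at h2
  rw [abs_mul, abs_mul, abs_of_nonneg h1]
  calc _ ≤ 2 / ((k : ℝ) + 1) * |c (k + 1)| * |zonal n (k + 1) x| := by gcongr
    _ = _ := by ring

/-- A potential of coefficients tending to zero is absolutely convergent away from the poles,
where it has at most a small multiple of a logarithmic singularity. -/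
lemma exists_abs_potential_le (hn : 2 ≤ n) {c : ℕ → ℝ} (hc : Tendsto c atTop (𝓝 0))
    {ε : ℝ} (hε : 0 < ε) : ∃ K : ℝ, ∀ x ∈ Ioo (-1 : ℝ) 1,
      Summable (fun k => |greenCoeff n (k + 1) * c (k + 1) * zonal n (k + 1) x|) ∧
      ∑' k, |greenCoeff n (k + 1) * c (k + 1) * zonal n (k + 1) x|
        ≤ K - ε * Real.log (1 - x ^ 2) := by
  obtain ⟨D, δ, hD, hδ, h⟩ := exists_abs_zonal_le hn
  obtain ⟨K, hK⟩ := exists_tsum_div_le hδ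
  -- chosen so that `2 ε'` times `2 / δ * log ((1 - x²) ^ (-1 / 8))` is `-ε * log (1 - x²)`
  set ε' := 2 * ε * δ with hε'
  have hε0 : 0 < ε' := by positivity
  obtain ⟨M, hM⟩ : ∃ M, ∀ k, |c k| ≤ M := by
    obtain ⟨M, hM⟩ := (Metric.isBounded_range_of_tendsto c hc).exists_norm_le
    exact ⟨M, fun k => hM _ ⟨k, rfl⟩⟩
  obtain ⟨L, hL⟩ : ∃ L, ∀ k ≥ L, |c k| ≤ ε' := by
    have := hc.abs
    rw [abs_zero] at this
    exact eventually_atTop.mp (this.eventually (ge_mem_nhds hε0))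
  have hM0 : 0 ≤ M := (abs_nonneg _).trans (hM 0)
  refine ⟨2 * ε' * (K + 2 / δ * Real.log D) + ∑ k ∈ Finset.range L, 2 * M, fun x hx => ?_⟩
  have hy := one_sub_sq_pos hx
  have hB : 1 ≤ D * (1 - x ^ 2) ^ (-(1 / 8) : ℝ) :=
    one_le_mul_of_one_le_of_one_le hD (one_le_rpow_neg hx (by norm_num))
  have hanti : ∀ k : ℕ, (((k + 1 : ℕ) : ℝ) + 1) ^ (-δ) ≤ ((k : ℝ) + 1) ^ (-δ) := fun k =>
    Real.rpow_le_rpow_of_nonpos (by positivity) (by push_cast; linarith) (by linarith)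
  obtain ⟨hS, hT⟩ := hK _ hB (fun k => |zonal n (k + 1) x|) (fun k => abs_nonneg _)
    (fun k => abs_zonal_le_one hn _ (by linarith)) (fun k => (h (k + 1) x hx).trans
      (mul_le_mul_of_nonneg_left (hanti k) (by linarith)))
  set a : ℕ → ℝ := fun k => if k ∈ Finset.range L then 2 * M else 0
  have ha : HasSum a (∑ k ∈ Finset.range L, 2 * M) := by
    have h2 : ∑ k ∈ Finset.range L, 2 * M = ∑ k ∈ Finset.range L, a k :=
      Finset.sum_congr rfl fun k hk => by simp only [a]; rw [if_pos hk]
    rw [h2]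
    exact hasSum_sum_of_ne_finset_zero fun k hk => by simp only [a]; rw [if_neg hk]
  have hle : ∀ k, |greenCoeff n (k + 1) * c (k + 1) * zonal n (k + 1) x|
      ≤ 2 * ε' * (|zonal n (k + 1) x| / (k + 1)) + a k := by
    intro k
    refine (abs_potential_term_le hn c k x).trans ?_
    have hr0 : 0 ≤ |zonal n (k + 1) x| / ((k : ℝ) + 1) := by positivity
    by_cases hk : k ∈ Finset.range L
    · have hr1 : |zonal n (k + 1) x| / ((k : ℝ) + 1) ≤ 1 := by
        rw [div_le_one (by positivity)]
        have := abs_zonal_le_one hn (k + 1) (x := x) (by linarith)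
        have : (0 : ℝ) ≤ k := by positivity
        linarith
      simp only [a]
      rw [if_pos hk]
      have h1 : 2 * |c (k + 1)| * (|zonal n (k + 1) x| / ((k : ℝ) + 1)) ≤ 2 * M * 1 := by
        gcongr
        exact hM _
      have h2 : 0 ≤ 2 * ε' * (|zonal n (k + 1) x| / ((k : ℝ) + 1)) := by positivity
      linarith
    · have hk' : L ≤ k := by simpa using hk
      simp only [a]
      rw [if_neg hk, add_zero]
      gcongr
      exact hL _ (by omega)
  have hsum := (hS.mul_left (2 * ε')).add ha.summable
  have hS' := Summable.of_nonneg_of_le (fun k => abs_nonneg _) hle hsum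
  refine ⟨hS', (hS'.tsum_le_tsum hle hsum).trans ?_⟩
  rw [(hS.mul_left (2 * ε')).tsum_add ha.summable, ha.tsum_eq, tsum_mul_left]
  rw [Real.log_mul (by positivity) (by positivity), Real.log_rpow hy] at hT
  have h5 := mul_le_mul_of_nonneg_left hT (by positivity : 0 ≤ 2 * ε')
  have h6 : 2 * ε' * (K + 2 / δ * (Real.log D + -(1 / 8) * Real.log (1 - x ^ 2)))
      = 2 * ε' * (K + 2 / δ * Real.log D) - ε * Real.log (1 - x ^ 2) := by
    rw [hε']; field_simp; ring
  rw [h6] at h5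
  linarith

/-! ### Potentials and their gradients -/

lemma hasSum_integral_of_rpow_bound (hn : 2 ≤ n) {F : ℕ → ℝ → ℝ} {b : ℕ → ℝ} {s : ℝ}
    (hs : s ≤ 1 / 2) (hF : ∀ k, AEStronglyMeasurable (F k) (zonalMeasure n)) (hb : Summable b)
    (hle : ∀ k, ∀ x ∈ Ioo (-1 : ℝ) 1, |F k x| ≤ b k * (1 - x ^ 2) ^ (-s)) :
    Integrable (fun x => ∑' k, F k x) (zonalMeasure n) ∧
      HasSum (fun k => ∫ x, F k x ∂(zonalMeasure n)) (∫ x, ∑' k, F k x ∂(zonalMeasure n)) := by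
  have hsum : ∀ x ∈ Ioo (-1 : ℝ) 1, Summable fun k => F k x := fun x hx =>
    Summable.of_norm_bounded (hb.mul_right _) fun k => hle k x hx
  have hmeas : AEStronglyMeasurable (fun x => ∑' k, F k x) (zonalMeasure n) := by
    refine aestronglyMeasurable_of_tendsto_ae (u := atTop)
      (f := fun N x => ∑ k ∈ Finset.range N, F k x) (fun N => ?_) ?_
    · exact Finset.aestronglyMeasurable_fun_sum _ fun k _ => hF k
    · filter_upwards [ae_zonalMeasure_mem n] with x hx using (hsum x hx).hasSum.tendsto_sum_nat
  constructor
  · refine integrable_of_abs_le_rpow hn hmeas (K := ∑' k, b k) hs fun x hx => ?_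
    rw [← tsum_mul_right]
    exact tsum_of_norm_bounded (f := fun k => F k x) (hb.mul_right _).hasSum
      fun k => hle k x hx
  · refine hasSum_integral_of_dominated_convergence (fun k x => b k * (1 - x ^ 2) ^ (-s)) hF
      (fun k => ?_) ?_ ?_ ?_
    · filter_upwards [ae_zonalMeasure_mem n] with x hx using hle k x hx
    · exact Eventually.of_forall fun x => hb.mul_right _
    · simp_rw [tsum_mul_right]
      refine integrable_of_abs_le_rpow hn ?_ (K := |∑' k, b k|) hs fun x hx => ?_
      · exact (by fun_prop : Measurable fun x : ℝ =>
          (∑' k, b k) * (1 - x ^ 2) ^ (-s)).aestronglyMeasurable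
      · have := one_sub_sq_pos hx
        rw [abs_mul, abs_of_nonneg (by positivity : 0 ≤ (1 - x ^ 2) ^ (-s))]
    · filter_upwards [ae_zonalMeasure_mem n] with x hx using (hsum x hx).hasSum

lemma exists_potential_term_bound (hn : 2 ≤ n) {c : ℕ → ℝ} (hc : Tendsto c atTop (𝓝 0)) :
    ∃ b : ℕ → ℝ, Summable b ∧ ∀ k, ∀ x ∈ Ioo (-1 : ℝ) 1,
      |greenCoeff n (k + 1) * c (k + 1) * zonal n (k + 1) x|
        ≤ b k * (1 - x ^ 2) ^ (-(1 / 8) : ℝ) := by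
  obtain ⟨D, δ, hD, hδ, h⟩ := exists_abs_zonal_le hn
  obtain ⟨M, hM⟩ : ∃ M, ∀ k, |c k| ≤ M := by
    obtain ⟨M, hM⟩ := (Metric.isBounded_range_of_tendsto c hc).exists_norm_le
    exact ⟨M, fun k => hM _ ⟨k, rfl⟩⟩
  refine ⟨fun k => 2 * M * D * ((k : ℝ) + 1) ^ (-(1 + δ)),
    (summable_rpow_succ (by linarith)).mul_left _, fun k x hx => ?_⟩
  have hy := one_sub_sq_pos hx
  have hk : (0 : ℝ) < k + 1 := by positivity
  have hM0 : 0 ≤ M := (abs_nonneg _).trans (hM 0)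
  refine (abs_potential_term_le hn c k x).trans ?_
  have h1 : |zonal n (k + 1) x| ≤ D * (1 - x ^ 2) ^ (-(1 / 8) : ℝ) * ((k : ℝ) + 1) ^ (-δ) := by
    refine (h (k + 1) x hx).trans (mul_le_mul_of_nonneg_left ?_ (by positivity))
    exact Real.rpow_le_rpow_of_nonpos hk (by push_cast; linarith) (by linarith)
  calc 2 * |c (k + 1)| * (|zonal n (k + 1) x| / (k + 1))
      ≤ 2 * M * ((D * (1 - x ^ 2) ^ (-(1 / 8) : ℝ) * ((k : ℝ) + 1) ^ (-δ)) / (k + 1)) := by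
        gcongr
        exact hM _
    _ = 2 * M * D * (((k : ℝ) + 1) ^ (-δ) / (k + 1)) * (1 - x ^ 2) ^ (-(1 / 8) : ℝ) := by ring
    _ = _ := by
      rw [← Real.rpow_sub_one hk.ne']; ring_nf

lemma potential_mul_zonal (hn : 2 ≤ n) {c : ℕ → ℝ} (hc : Tendsto c atTop (𝓝 0)) (j : ℕ) :
    Integrable (fun x => zonalPotential n c x * zonal n j x) (zonalMeasure n) ∧
      HasSum (fun k => greenCoeff n (k + 1) * c (k + 1) *
          ∫ x, zonal n (k + 1) x * zonal n j x ∂(zonalMeasure n))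
        (zonalCoeff n (zonalPotential n c) j) := by
  obtain ⟨b, hb, hle⟩ := exists_potential_term_bound hn hc
  have h := hasSum_integral_of_rpow_bound hn (s := 1 / 8) (by norm_num) (b := b)
    (F := fun k x => greenCoeff n (k + 1) * c (k + 1) * zonal n (k + 1) x * zonal n j x)
    (fun k => (((continuous_zonal n (k + 1)).const_mul _).mul
      (continuous_zonal n j)).aestronglyMeasurable) hb (fun k x hx => by
        rw [abs_mul]
        exact (mul_le_of_le_one_right (abs_nonneg _)
          (abs_zonal_le_one hn j (by linarith [one_sub_sq_pos hx]))).trans (hle k x hx))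
  simp_rw [tsum_mul_right] at h
  refine ⟨h.1, ?_⟩
  have h2 := h.2
  simp_rw [mul_assoc (greenCoeff n _ * c _)] at h2
  simp_rw [integral_const_mul] at h2
  exact h2

lemma integrable_potential (hn : 2 ≤ n) {c : ℕ → ℝ} (hc : Tendsto c atTop (𝓝 0)) :
    Integrable (zonalPotential n c) (zonalMeasure n) := by
  simpa using (potential_mul_zonal hn hc 0).1

lemma zonalCoeff_potential_zero (hn : 2 ≤ n) {c : ℕ → ℝ} (hc : Tendsto c atTop (𝓝 0)) :
    zonalCoeff n (zonalPotential n c) 0 = 0 := by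
  have h := (potential_mul_zonal hn hc 0).2
  have h0 : ∀ k, greenCoeff n (k + 1) * c (k + 1) *
      ∫ x, zonal n (k + 1) x * zonal n 0 x ∂(zonalMeasure n) = 0 := fun k => by
    rw [integral_zonal_mul_of_ne hn (by omega), mul_zero]
  simp_rw [h0] at h
  exact h.unique hasSum_zero

lemma zonalCoeff_potential_succ (hn : 2 ≤ n) {c : ℕ → ℝ} (hc : Tendsto c atTop (𝓝 0)) (j : ℕ) :
    zonalCoeff n (zonalPotential n c) (j + 1)
      = greenCoeff n (j + 1) * c (j + 1) * zonalNormSq n (j + 1) := by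
  have h := (potential_mul_zonal hn hc (j + 1)).2
  refine h.unique (hasSum_single j fun k hk => ?_)
  rw [integral_zonal_mul_of_ne hn (by omega), mul_zero]

/-- A function is recovered from its mean and the coefficients of its Paneitz image. -/
lemma ae_eq_const_add_potential (hn : 2 ≤ n) {g : ℝ → ℝ} (hg : Integrable g (zonalMeasure n))
    {c : ℕ → ℝ} (hc : Tendsto c atTop (𝓝 0))
    (hcoef : ∀ k, c k = (∏ j ∈ Finset.range n, ((k : ℝ) + j)) * zonalCoeff n g k) :
    g =ᵐ[zonalMeasure n] fun x => zonalCoeff n g 0 + zonalPotential n c x := by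
  have hp := isProbabilityMeasure_zonalMeasure hn
  have hP := integrable_potential hn hc
  have hU : Integrable (fun x => zonalCoeff n g 0 + zonalPotential n c x) (zonalMeasure n) :=
    (integrable_const _).add hP
  have key := ae_eq_zero_of_integral_zonal_eq_zero hn (hg.sub hU) fun k => by
    simp only [Pi.sub_apply, sub_mul, add_mul]
    rw [integral_sub (integrable_mul_zonal hn hg k), integral_add
      ((integrable_of_continuous hn (continuous_zonal n k)).const_mul _)
      (potential_mul_zonal hn hc k).1, integral_const_mul]
    · rcases k with _ | k
      · have h1 := zonalCoeff_potential_zero hn hc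
        simp only [zonalCoeff] at h1 ⊢
        rw [h1]; simp
      · have h1 := zonalCoeff_potential_succ hn hc k
        have h2 := integral_zonal_mul_of_ne hn (show 0 ≠ k + 1 by omega)
        have h3 := greenCoeff_mul hn (Nat.le_add_left 1 k)
        simp only [zonal_zero, one_mul] at h2
        have h4 := hcoef (k + 1)
        rw [zonalCoeff] at h1
        rw [h1, h2, h4, ← zonalCoeff]
        linear_combination -zonalCoeff n g (k + 1) * h3
    · exact ((integrable_of_continuous hn (continuous_zonal n k)).const_mul _).add
        (potential_mul_zonal hn hc k).1
  filter_upwards [key] with x hx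
  simpa [sub_eq_zero] using hx

/-- Bessel's inequality for zonal coefficients. -/
lemma summable_sq_zonalCoeff (hn : 2 ≤ n) {v : ℝ → ℝ} (hv : Integrable v (zonalMeasure n))
    (hv2 : Integrable (fun x => v x ^ 2) (zonalMeasure n)) :
    Summable fun k : ℕ => ((k : ℝ) + 1) * zonalCoeff n v k ^ 2 := by
  have hpart : ∀ K, ∑ k ∈ Finset.range K, zonalCoeff n v k ^ 2 / zonalNormSq n k
      ≤ ∫ x, v x ^ 2 ∂(zonalMeasure n) := by
    intro K
    set a : ℕ → ℝ := fun k => zonalCoeff n v k / zonalNormSq n k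
    set s : ℝ → ℝ := fun x => ∑ k ∈ Finset.range K, a k * zonal n k x
    have hsc : Continuous s := continuous_finsetSum _ fun k _ =>
      (continuous_zonal n k).const_mul _
    have hsi : ∀ k, Integrable (fun x => s x * zonal n k x) (zonalMeasure n) := fun k =>
      integrable_of_continuous hn (hsc.mul (continuous_zonal n k))
    have hvs : ∫ x, v x * s x ∂(zonalMeasure n)
        = ∑ k ∈ Finset.range K, zonalCoeff n v k ^ 2 / zonalNormSq n k := by
      simp only [s, Finset.mul_sum, mul_left_comm (v _)]
      rw [integral_finsetSum _ fun k _ => (integrable_mul_zonal hn hv k).const_mul _]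
      refine Finset.sum_congr rfl fun k _ => ?_
      rw [integral_const_mul, ← zonalCoeff]
      simp only [a]; ring
    have hss : ∫ x, s x * s x ∂(zonalMeasure n)
        = ∑ k ∈ Finset.range K, zonalCoeff n v k ^ 2 / zonalNormSq n k := by
      have h1 : ∀ j ∈ Finset.range K, ∫ x, s x * zonal n j x ∂(zonalMeasure n)
          = zonalCoeff n v j := by
        intro j hj
        simp only [s, Finset.sum_mul, mul_assoc]
        rw [integral_finsetSum _ fun k _ => (integrable_zonal_mul hn k j).const_mul _,
          Finset.sum_eq_single_of_mem j hj fun k _ hk => by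
            rw [integral_const_mul, integral_zonal_mul_of_ne hn hk, mul_zero],
          integral_const_mul, ← zonalNormSq]
        have := (zonalNormSq_pos hn j).ne'
        simp only [a]; field_simp
      calc ∫ x, s x * s x ∂(zonalMeasure n)
          = ∫ x, ∑ j ∈ Finset.range K, a j * (s x * zonal n j x) ∂(zonalMeasure n) := by
            congr 1; ext x
            conv_lhs => rw [show s x * s x = s x * ∑ k ∈ Finset.range K, a k * zonal n k x from rfl]
            rw [Finset.mul_sum]
            exact Finset.sum_congr rfl fun k _ => by ring
        _ = ∑ j ∈ Finset.range K, a j * zonalCoeff n v j := by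
            rw [integral_finsetSum _ fun k _ => (hsi k).const_mul _]
            refine Finset.sum_congr rfl fun k hk => ?_
            rw [integral_const_mul, h1 k hk]
        _ = _ := Finset.sum_congr rfl fun k _ => by simp only [a]; ring
    have hivs : Integrable (fun x => v x * s x) (zonalMeasure n) := by
      simp only [s, Finset.mul_sum, mul_left_comm (v _)]
      exact integrable_finsetSum _ fun k _ => (integrable_mul_zonal hn hv k).const_mul _
    have hiss : Integrable (fun x => s x * s x) (zonalMeasure n) :=
      integrable_of_continuous hn (hsc.mul hsc)
    have hdiff : Integrable (fun x => v x ^ 2 - 2 * (v x * s x)) (zonalMeasure n) :=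
      hv2.sub (hivs.const_mul 2)
    have h0 : 0 ≤ ∫ x, (v x ^ 2 - 2 * (v x * s x) + s x * s x) ∂(zonalMeasure n) :=
      integral_nonneg fun x => by
        have := sq_nonneg (v x - s x)
        simp only [Pi.zero_apply]
        nlinarith
    rw [integral_add hdiff hiss, integral_sub hv2 (hivs.const_mul 2),
      integral_const_mul, hvs, hss] at h0
    linarith
  refine summable_of_sum_range_le (c := ∫ x, v x ^ 2 ∂(zonalMeasure n))
    (fun k => by positivity) fun K => (Finset.sum_le_sum fun k _ => ?_).trans (hpart K)
  have h1 := zonalNormSq_le hn k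
  have h2 := zonalNormSq_pos hn k
  rw [le_div_iff₀ (by positivity)] at h1
  rw [le_div_iff₀ h2]
  nlinarith [sq_nonneg (zonalCoeff n v k)]

/-- The function `(1 - x²) U'` for the potential `U` of the coefficients `c`: the derivative of `U`
in the direction of the conformal vector field of the axis. -/
noncomputable def zonalGradient (n : ℕ) (c : ℕ → ℝ) (x : ℝ) : ℝ :=
  ∑' k, c (k + 1) * (zonal n k x - zonal n (k + 2) x) / (n - 1).factorial

lemma exists_gradient_term_bound (hn : 2 ≤ n) {c : ℕ → ℝ}
    (hc : Summable fun k : ℕ => ((k : ℝ) + 1) * c k ^ 2) :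
    ∃ b : ℕ → ℝ, Summable b ∧ ∀ k, ∀ x ∈ Ioo (-1 : ℝ) 1,
      |c (k + 1) * (zonal n k x - zonal n (k + 2) x) / (n - 1).factorial|
        ≤ b k * (1 - x ^ 2) ^ (-(1 / 8) : ℝ) := by
  obtain ⟨D, δ, hD, hδ, h⟩ := exists_abs_zonal_le hn
  refine ⟨fun k => 2 * D * (|c (k + 1)| * ((k : ℝ) + 1) ^ (-δ)), ?_, fun k x hx => ?_⟩
  · refine Summable.mul_left _ ?_
    refine Summable.of_nonneg_of_le (fun k => by positivity) (fun k => ?_)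
      (((summable_nat_add_iff 1).mpr hc).add (summable_rpow_succ (s := 1 + 2 * δ) (by linarith)))
    have hk : (0 : ℝ) < k + 1 := by positivity
    have h1 : ((k : ℝ) + 1) ^ (-(1 + 2 * δ)) = (((k : ℝ) + 1) ^ (-δ)) ^ 2 * ((k : ℝ) + 1)⁻¹ := by
      rw [← Real.rpow_natCast, ← Real.rpow_mul hk.le, ← Real.rpow_neg_one, ← Real.rpow_add hk]
      congr 1; push_cast; ring
    rw [h1, ← sq_abs (c (k + 1))]
    push_cast
    set t := ((k : ℝ) + 1) ^ (-δ)
    set m := (k : ℝ) + 1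
    have h2 : |c (k + 1)| * t ≤ m * |c (k + 1)| ^ 2 + t ^ 2 * m⁻¹ := by
      have h3 : m * |c (k + 1)| ^ 2 + t ^ 2 * m⁻¹ - |c (k + 1)| * t
          = m * ((|c (k + 1)| - t * m⁻¹ / 2) ^ 2 + 3 / 4 * (t * m⁻¹) ^ 2) := by
        field_simp; ring
      have : 0 ≤ m * ((|c (k + 1)| - t * m⁻¹ / 2) ^ 2 + 3 / 4 * (t * m⁻¹) ^ 2) := by positivity
      linarith
    nlinarith [sq_nonneg |c (k + 1)|]
  · have hy := one_sub_sq_pos hx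
    have hk : (0 : ℝ) < k + 1 := by positivity
    have h1 := h k x hx
    have h2 : |zonal n (k + 2) x| ≤ D * (1 - x ^ 2) ^ (-(1 / 8) : ℝ) * ((k : ℝ) + 1) ^ (-δ) := by
      refine (h (k + 2) x hx).trans (mul_le_mul_of_nonneg_left ?_ (by positivity))
      exact Real.rpow_le_rpow_of_nonpos hk (by push_cast; linarith) (by linarith)
    have h3 : |zonal n k x - zonal n (k + 2) x|
        ≤ 2 * (D * (1 - x ^ 2) ^ (-(1 / 8) : ℝ) * ((k : ℝ) + 1) ^ (-δ)) :=
      (abs_sub _ _).trans (by linarith)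
    have h4 : (1 : ℝ) ≤ (n - 1).factorial := by exact_mod_cast Nat.factorial_pos _
    rw [abs_div, abs_mul, abs_of_nonneg (by positivity : (0 : ℝ) ≤ (n - 1).factorial)]
    refine (div_le_self (by positivity) h4).trans ?_
    calc |c (k + 1)| * |zonal n k x - zonal n (k + 2) x|
        ≤ |c (k + 1)| * (2 * (D * (1 - x ^ 2) ^ (-(1 / 8) : ℝ) * ((k : ℝ) + 1) ^ (-δ))) := by
          gcongr
      _ = _ := by ring

lemma greenCoeff_mul_zonalDeriv (hn : 2 ≤ n) (k : ℕ) (x : ℝ) :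
    (1 - x ^ 2) * (greenCoeff n (k + 1) * zonalDeriv n (k + 1) x)
      = (zonal n k x - zonal n (k + 2) x) / (n - 1).factorial := by
  have h1 := one_sub_sq_mul_zonalDeriv_succ hn k x
  have h2 := mul_zonal_succ hn k x
  rw [mul_left_comm, h1, h2, greenCoeff]
  have h3 : (2 * k + n + 1 : ℝ) ≠ 0 := by positivity
  have h4 : (k + n : ℝ) ≠ 0 := by positivity
  have h5 : (k + 1 : ℝ) ≠ 0 := by positivity
  have h6 : ((n - 1).factorial : ℝ) ≠ 0 := by positivity
  have h7 : (((k + 1 : ℕ) : ℝ) + n - 1) = k + n := by push_cast; ring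
  have h8 : (2 * ((k + 1 : ℕ) : ℝ) + n - 1) = 2 * k + n + 1 := by push_cast; ring
  rw [h7, h8]
  push_cast
  field_simp
  ring

lemma hasDerivAt_potential (hn : 2 ≤ n) {c : ℕ → ℝ} (hc0 : Tendsto c atTop (𝓝 0))
    (hc : Summable fun k : ℕ => ((k : ℝ) + 1) * c k ^ 2) {x : ℝ} (hx : x ∈ Ioo (-1 : ℝ) 1) :
    HasDerivAt (zonalPotential n c) (zonalGradient n c x / (1 - x ^ 2)) x := by
  obtain ⟨b, hb, hle⟩ := exists_gradient_term_bound hn hc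
  obtain ⟨b', hb', hle'⟩ := exists_potential_term_bound hn hc0
  obtain ⟨ρ, hxρ, hρ1⟩ := exists_between (abs_lt.mpr hx)
  have hρ0 : 0 < ρ := (abs_nonneg x).trans_lt hxρ
  have hsub : ∀ t ∈ Ioo (-ρ) ρ, t ∈ Ioo (-1 : ℝ) 1 := fun t ht =>
    ⟨by linarith [ht.1], by linarith [ht.2]⟩
  have hderiv : ∀ k, ∀ t ∈ Ioo (-1 : ℝ) 1,
      greenCoeff n (k + 1) * c (k + 1) * zonalDeriv n (k + 1) t
        = c (k + 1) * (zonal n k t - zonal n (k + 2) t) / (n - 1).factorial / (1 - t ^ 2) := by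
    intro k t ht
    rw [eq_div_iff (one_sub_sq_pos ht).ne', mul_div_assoc, ← greenCoeff_mul_zonalDeriv hn]
    ring
  have hb0 : ∀ k, 0 ≤ b k := fun k => by
    have := (abs_nonneg _).trans (hle k 0 (by norm_num))
    simpa using this
  have key := hasDerivAt_tsum_of_isPreconnected
    (u := fun k => b k * ((1 - ρ ^ 2) ^ (-(1 / 8) : ℝ) / (1 - ρ ^ 2)))
    (g := fun k t => greenCoeff n (k + 1) * c (k + 1) * zonal n (k + 1) t)
    (g' := fun k t => greenCoeff n (k + 1) * c (k + 1) * zonalDeriv n (k + 1) t)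
    (hb.mul_right _) (isOpen_Ioo (a := -ρ) (b := ρ)) isPreconnected_Ioo
    (fun k t _ => (hasDerivAt_zonal n (k + 1) t).const_mul _) (fun k t ht => ?_)
    (y₀ := 0) (by simpa using hρ0) ?_ (y := x) (abs_lt.mp hxρ)
  · refine key.congr_deriv ?_
    rw [zonalGradient, ← tsum_div_const]
    exact tsum_congr fun k => hderiv k x hx
  · have hρy : 0 < 1 - ρ ^ 2 := one_sub_sq_pos ⟨by linarith, hρ1⟩
    have hty : 1 - ρ ^ 2 ≤ 1 - t ^ 2 := by nlinarith [ht.1, ht.2]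
    have hty0 : 0 < 1 - t ^ 2 := by linarith
    rw [hderiv k t (hsub t ht), norm_div, Real.norm_eq_abs, Real.norm_of_nonneg hty0.le,
      ← mul_div_assoc]
    refine div_le_div₀ (by have := hb0 k; positivity) ((hle k t (hsub t ht)).trans ?_) hρy hty
    refine mul_le_mul_of_nonneg_left ?_ (hb0 k)
    exact Real.rpow_le_rpow_of_nonpos hρy hty (by norm_num)
  · exact Summable.of_norm_bounded (hb'.mul_right _) fun k => hle' k 0 (by norm_num)

/-! ### The pairing identity and rigidity -/

/-- Term by term integration of `v` times `x` times a gradient. -/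
lemma gradient_mul (hn : 2 ≤ n) {c : ℕ → ℝ} (hc : Summable fun k : ℕ => ((k : ℝ) + 1) * c k ^ 2)
    {v : ℝ → ℝ} (hv : AEStronglyMeasurable v (zonalMeasure n)) {K : ℝ}
    (hK : ∀ x ∈ Ioo (-1 : ℝ) 1, |v x| ≤ K * (1 - x ^ 2) ^ (-(1 / 8) : ℝ)) :
    Integrable (fun x => zonalGradient n c x * (v x * x)) (zonalMeasure n) ∧
      HasSum (fun k => c (k + 1) / (n - 1).factorial *
          ∫ x, (zonal n k x - zonal n (k + 2) x) * (v x * x) ∂(zonalMeasure n))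
        (∫ x, zonalGradient n c x * (v x * x) ∂(zonalMeasure n)) := by
  obtain ⟨b, hb, hle⟩ := exists_gradient_term_bound hn hc
  have h := hasSum_integral_of_rpow_bound hn (s := 1 / 4) (by norm_num) (b := fun k => b k * K)
    (F := fun k x => c (k + 1) * (zonal n k x - zonal n (k + 2) x) / (n - 1).factorial * (v x * x))
    (fun k => by
      have h1 := continuous_zonal n k
      have h2 := continuous_zonal n (k + 2)
      have h3 : Continuous fun x => c (k + 1) * (zonal n k x - zonal n (k + 2) x)
        / (n - 1).factorial := by fun_prop
      exact h3.aestronglyMeasurable.mul (hv.mul continuous_id.aestronglyMeasurable))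
    (hb.mul_right K) (fun k x hx => by
      have hy := one_sub_sq_pos hx
      have hx1 : |x| ≤ 1 := (abs_lt.mpr hx).le
      have hvx : |v x * x| ≤ K * (1 - x ^ 2) ^ (-(1 / 8) : ℝ) := by
        rw [abs_mul]
        exact (mul_le_of_le_one_right (abs_nonneg _) hx1).trans (hK x hx)
      rw [abs_mul]
      calc _ ≤ (b k * (1 - x ^ 2) ^ (-(1 / 8) : ℝ)) * (K * (1 - x ^ 2) ^ (-(1 / 8) : ℝ)) :=
            mul_le_mul (hle k x hx) hvx (abs_nonneg _) ((abs_nonneg _).trans (hle k x hx))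
        _ = b k * K * ((1 - x ^ 2) ^ (-(1 / 8) : ℝ) * (1 - x ^ 2) ^ (-(1 / 8) : ℝ)) := by ring
        _ = _ := by rw [← Real.rpow_add hy]; norm_num)
  simp_rw [tsum_mul_right] at h
  refine ⟨h.1, ?_⟩
  have h2 := h.2
  refine h2.congr_fun fun k => ?_
  rw [← integral_const_mul]
  congr 1; ext x; ring

/-- The pairing of `e^{nU}` with `x (1 - x²) U'` is the coefficient of `e^{nU}` of degree two:
`n e^{nU} U'` is the derivative of `e^{nU}`, and the divergence `(n + 1) x² - 1` that appears after
integrating by parts is `n` times the zonal polynomial of degree two. -/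
lemma integral_exp_mul_gradient (hn : 2 ≤ n) {U G : ℝ → ℝ}
    (hU : ∀ x ∈ Ioo (-1 : ℝ) 1, HasDerivAt U (G x / (1 - x ^ 2)) x) {K : ℝ}
    (hK : ∀ x ∈ Ioo (-1 : ℝ) 1, Real.exp (n * U x) ≤ K * (1 - x ^ 2) ^ (-(1 / 8) : ℝ))
    (hf : Integrable (fun x => Real.exp (n * U x)) (zonalMeasure n))
    (hi : Integrable (fun x => G x * (Real.exp (n * U x) * x)) (zonalMeasure n)) :
    ∫ x, G x * (Real.exp (n * U x) * x) ∂(zonalMeasure n)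
      = zonalCoeff n (fun x => Real.exp (n * U x)) 2 := by
  have hn' : (2 : ℝ) ≤ n := by exact_mod_cast hn
  have hn0 : (n : ℝ) ≠ 0 := by positivity
  have hF : ∀ x ∈ Ioo (-1 : ℝ) 1, HasDerivAt (fun x => x * Real.exp (n * U x))
      (Real.exp (n * U x) + x * (Real.exp (n * U x) * (n * (G x / (1 - x ^ 2))))) x := by
    intro x hx
    exact ((hasDerivAt_id x).mul (((hU x hx).const_mul (n : ℝ)).exp)).congr_deriv (by simp)
  have hR2 : ∀ x : ℝ, n * zonal n 2 x = (n + 1) * x ^ 2 - 1 := by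
    intro x
    have := zonal_add_two hn 0 x
    simp only [zero_add, zonal_one, zonal_zero] at this
    push_cast at this
    linear_combination this
  have hid : ∀ x ∈ Ioo (-1 : ℝ) 1,
      (1 - x ^ 2) * (Real.exp (n * U x) + x * (Real.exp (n * U x) * (n * (G x / (1 - x ^ 2)))))
        - n * x * (x * Real.exp (n * U x))
      = n * (G x * (Real.exp (n * U x) * x)) - n * (Real.exp (n * U x) * zonal n 2 x) := by
    intro x hx
    have hy := (one_sub_sq_pos hx).ne'
    have h1 := hR2 x
    have h2 : (1 - x ^ 2) * (G x / (1 - x ^ 2)) = G x := by field_simp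
    linear_combination (x * Real.exp (n * U x) * n) * h2 + Real.exp (n * U x) * h1
  have hae : (fun x => (1 - x ^ 2) * (Real.exp (n * U x) + x * (Real.exp (n * U x) *
      (n * (G x / (1 - x ^ 2))))) - n * x * (x * Real.exp (n * U x)))
      =ᵐ[zonalMeasure n] fun x => n * (G x * (Real.exp (n * U x) * x))
        - n * (Real.exp (n * U x) * zonal n 2 x) := by
    filter_upwards [ae_zonalMeasure_mem n] with x hx using hid x hx
  have hi2 := integrable_mul_zonal hn hf 2
  have hint := (hi.const_mul (n : ℝ)).sub (hi2.const_mul (n : ℝ))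
  have hlim : ∀ a : ℝ, a ^ 2 = 1 → ∀ l : Filter ℝ, l ≤ 𝓝 a → (∀ᶠ x in l, x ∈ Ioo (-1 : ℝ) 1) →
      Tendsto (fun x => (1 - x ^ 2) ^ ((n : ℝ) / 2) * (x * Real.exp (n * U x))) l (𝓝 0) := by
    intro a ha l hl hmem
    have hs : (0 : ℝ) < (n : ℝ) / 2 + -(1 / 8) := by linarith
    have hcont : Continuous fun x : ℝ => K * (1 - x ^ 2) ^ ((n : ℝ) / 2 + -(1 / 8)) :=
      ((continuous_const.sub (continuous_id.pow 2)).rpow_const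
        fun _ => Or.inr hs.le).const_mul K
    have h0 : Tendsto (fun x : ℝ => K * (1 - x ^ 2) ^ ((n : ℝ) / 2 + -(1 / 8))) l (𝓝 0) := by
      have := (hcont.tendsto a).mono_left hl
      rwa [ha, sub_self, Real.zero_rpow hs.ne', mul_zero] at this
    refine squeeze_zero_norm' ?_ h0
    filter_upwards [hmem] with x hx
    have hy := one_sub_sq_pos hx
    have hx1 : |x| ≤ 1 := (abs_lt.mpr hx).le
    rw [norm_mul, norm_mul, Real.norm_of_nonneg (by positivity), Real.norm_eq_abs,
      Real.norm_of_nonneg (Real.exp_pos _).le]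
    calc (1 - x ^ 2) ^ ((n : ℝ) / 2) * (|x| * Real.exp (n * U x))
        ≤ (1 - x ^ 2) ^ ((n : ℝ) / 2) * (1 * (K * (1 - x ^ 2) ^ (-(1 / 8) : ℝ))) := by
          gcongr
          exact hK x hx
      _ = _ := by rw [Real.rpow_add hy]; ring
  have hdiv := integral_divergence hn hF (hint.congr hae.symm)
    (hlim (-1) (by norm_num) _ nhdsWithin_le_nhds (Ioo_mem_nhdsGT (by norm_num)))
    (hlim 1 (by norm_num) _ nhdsWithin_le_nhds (Ioo_mem_nhdsLT (by norm_num)))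
  rw [integral_congr_ae hae, integral_sub (hi.const_mul _) (hi2.const_mul _),
    integral_const_mul, integral_const_mul, ← mul_sub] at hdiv
  have := (mul_eq_zero.mp hdiv).resolve_left hn0
  rw [zonalCoeff]
  linarith

lemma mul_zonal (hn : 2 ≤ n) (k : ℕ) (x : ℝ) :
    x * zonal n k x =
      ((k + n - 1) * zonal n (k + 1) x + k * zonal n (k - 1) x) / (2 * k + n - 1) := by
  rcases k with _ | k
  · have h2 : (2 : ℝ) ≤ n := by exact_mod_cast hn
    have : (n : ℝ) - 1 ≠ 0 := by intro h; linarith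
    simp
    field_simp
  · rw [mul_zonal_succ hn]
    push_cast
    congr 1 <;> ring

lemma integral_mul_zonal (hn : 2 ≤ n) {v : ℝ → ℝ} (hv : Integrable v (zonalMeasure n)) (k : ℕ) :
    ∫ x, (zonal n k x - zonal n (k + 2) x) * (v x * x) ∂(zonalMeasure n)
      = ((k + n - 1) * zonalCoeff n v (k + 1) + k * zonalCoeff n v (k - 1)) / (2 * k + n - 1)
        - ((k + n + 1) * zonalCoeff n v (k + 3) + (k + 2) * zonalCoeff n v (k + 1))
          / (2 * k + n + 3) := by
  have hi := integrable_mul_zonal hn hv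
  have h : ∀ x, (zonal n k x - zonal n (k + 2) x) * (v x * x)
      = ((k + n - 1) / (2 * k + n - 1) * (v x * zonal n (k + 1) x)
          + k / (2 * k + n - 1) * (v x * zonal n (k - 1) x))
        - ((k + n + 1) / (2 * k + n + 3) * (v x * zonal n (k + 3) x)
          + (k + 2) / (2 * k + n + 3) * (v x * zonal n (k + 1) x)) := by
    intro x
    have h1 := mul_zonal hn k x
    have h2 := mul_zonal_succ hn (k + 1) x
    push_cast at h2
    calc _ = v x * (x * zonal n k x) - v x * (x * zonal n (k + 2) x) := by ring
      _ = _ := by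
        rw [h1, h2]
        ring
  simp_rw [h]
  have hA := ((hi (k + 1)).const_mul ((k + n - 1) / (2 * k + n - 1) : ℝ)).add
    ((hi (k - 1)).const_mul (k / (2 * k + n - 1) : ℝ))
  have hB := ((hi (k + 3)).const_mul ((k + n + 1) / (2 * k + n + 3) : ℝ)).add
    ((hi (k + 1)).const_mul ((k + 2) / (2 * k + n + 3) : ℝ))
  have hAB := integral_sub hA hB
  simp only [Pi.add_apply] at hAB
  rw [hAB, integral_add ((hi _).const_mul _) ((hi _).const_mul _),
    integral_add ((hi _).const_mul _) ((hi _).const_mul _)]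
  simp only [integral_const_mul, zonalCoeff]
  ring

/-- The boundary term in the summation by parts for the quadratic form of `x (1 - x²) d/dx`. -/
noncomputable def boundaryTerm (n : ℕ) (c : ℕ → ℝ) (k : ℕ) : ℝ :=
  ((k + n) * (c k * c (k + 2)) + (k + 1) * c k ^ 2) / (2 * k + n + 1)

/-- The quadratic form `∫ P u · x (1 - x²) u'` in terms of the coefficients of `P u` is, up to
boundary terms, a sum of squares. -/
lemma sum_pairing_eq (hn : 2 ≤ n) {c : ℕ → ℝ} (hc0 : c 0 = 0) (K : ℕ) :
    ∑ k ∈ Finset.range (K + 1), c (k + 1) *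
      (((k + n - 1) * c (k + 1) + k * c (k - 1)) / (2 * k + n - 1)
        - ((k + n + 1) * c (k + 3) + (k + 2) * c (k + 1)) / (2 * k + n + 3))
    = 1 / 2 * c 1 ^ 2
      + (n - 1) / 2 * ∑ k ∈ Finset.range K, (c k - c (k + 2)) ^ 2 / (2 * k + n + 1)
      + 1 / 2 * (c (K + 1) ^ 2 + c K ^ 2) - boundaryTerm n c K - boundaryTerm n c (K + 1) := by
  have h2 : (2 : ℝ) ≤ n := by exact_mod_cast hn
  induction K with
  | zero =>
    have : (n : ℝ) - 1 ≠ 0 := by intro h; linarith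
    have : (n : ℝ) + 3 ≠ 0 := by positivity
    have : (2 + n + 1 : ℝ) ≠ 0 := by positivity
    simp [boundaryTerm, hc0]
    field_simp
    ring
  | succ K ih =>
    rw [Finset.sum_range_succ, ih, Finset.sum_range_succ (fun k : ℕ =>
      (c k - c (k + 2)) ^ 2 / (2 * (k : ℝ) + n + 1))]
    have h3 : (2 * K + n + 1 : ℝ) ≠ 0 := by positivity
    have h4 : (2 * K + n + 3 : ℝ) ≠ 0 := by positivity
    have h5 : (2 * K + n + 5 : ℝ) ≠ 0 := by positivity
    have e1 : (2 * ((K + 1 : ℕ) : ℝ) + n - 1) = 2 * K + n + 1 := by push_cast; ring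
    have e2 : (2 * ((K + 1 : ℕ) : ℝ) + n + 3) = 2 * K + n + 5 := by push_cast; ring
    have e3 : (2 * ((K + 1 : ℕ) : ℝ) + n + 1) = 2 * K + n + 3 := by push_cast; ring
    have e4 : (2 * ((K + 1 + 1 : ℕ) : ℝ) + n + 1) = 2 * K + n + 5 := by push_cast; ring
    simp only [boundaryTerm, e1, e2, e3, e4, Nat.add_sub_cancel,
      show K + 1 + 1 = K + 2 from rfl, show K + 1 + 2 = K + 3 from rfl,
      show K + 1 + 3 = K + 4 from rfl]
    push_cast
    field_simp
    ring

lemma tendsto_boundaryTerm (hn : 2 ≤ n) {c : ℕ → ℝ} (hc : Tendsto c atTop (𝓝 0)) :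
    Tendsto (boundaryTerm n c) atTop (𝓝 0) := by
  have h2 : (2 : ℝ) ≤ n := by exact_mod_cast hn
  have hlim : Tendsto (fun k => |c k| * |c (k + 2)| + c k ^ 2) atTop (𝓝 0) := by
    have h1 := hc.abs
    have h3 := h1.comp (tendsto_add_atTop_nat 2)
    simpa using (h1.mul h3).add (hc.pow 2)
  refine squeeze_zero_norm (fun k => ?_) hlim
  have hk : (0 : ℝ) ≤ k := by positivity
  have hpos : (0 : ℝ) < 2 * k + n + 1 := by positivity
  rw [boundaryTerm, norm_div, Real.norm_of_nonneg hpos.le, div_le_iff₀ hpos, Real.norm_eq_abs]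
  calc _ ≤ |(k + n) * (c k * c (k + 2))| + |(k + 1) * c k ^ 2| := abs_add_le _ _
    _ = (k + n) * (|c k| * |c (k + 2)|) + (k + 1) * c k ^ 2 := by
      rw [abs_mul, abs_mul, abs_of_nonneg (by positivity : (0 : ℝ) ≤ k + n),
        abs_of_nonneg (by positivity : (0 : ℝ) ≤ (k + 1) * c k ^ 2)]
    _ ≤ (2 * k + n + 1) * (|c k| * |c (k + 2)|) + (2 * k + n + 1) * c k ^ 2 := by
      exact add_le_add (mul_le_mul_of_nonneg_right (by linarith) (by positivity))
        (mul_le_mul_of_nonneg_right (by linarith) (by positivity))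
    _ = _ := by ring

/-- Vanishing of the quadratic form `∫ P u · x (1 - x²) u'` forces `P u = 0`. -/
lemma coeff_eq_zero_of_pairing (hn : 2 ≤ n) {c : ℕ → ℝ} (hc0 : c 0 = 0)
    (hc : Tendsto c atTop (𝓝 0))
    (hsum : HasSum (fun k : ℕ => c (k + 1) *
      (((k + n - 1) * c (k + 1) + k * c (k - 1)) / (2 * k + n - 1)
        - ((k + n + 1) * c (k + 3) + (k + 2) * c (k + 1)) / (2 * k + n + 3))) 0) (k : ℕ) :
    c k = 0 := by
  have h2 : (2 : ℝ) ≤ n := by exact_mod_cast hn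
  set Q : ℕ → ℝ := fun K => 1 / 2 * c 1 ^ 2
      + (n - 1) / 2 * ∑ k ∈ Finset.range K, (c k - c (k + 2)) ^ 2 / (2 * k + n + 1)
  have hQ : Tendsto Q atTop (𝓝 0) := by
    have h1 := (hsum.tendsto_sum_nat.comp (tendsto_add_atTop_nat 1))
    have h3 : Tendsto (fun K => 1 / 2 * (c (K + 1) ^ 2 + c K ^ 2) - boundaryTerm n c K
        - boundaryTerm n c (K + 1)) atTop (𝓝 0) := by
      have hb := tendsto_boundaryTerm hn hc
      have hc1 := hc.comp (tendsto_add_atTop_nat 1)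
      have hb1 := hb.comp (tendsto_add_atTop_nat 1)
      have h4 := ((((hc1.pow 2).add (hc.pow 2)).const_mul (1 / 2)).sub hb).sub hb1
      have h5 : (1 / 2 : ℝ) * (0 ^ 2 + 0 ^ 2) - 0 - 0 = 0 := by norm_num
      rw [h5] at h4
      exact h4
    have h4 := h1.sub h3
    rw [sub_zero] at h4
    refine h4.congr fun K => ?_
    simp only [Function.comp_apply, Q]
    rw [sum_pairing_eq hn hc0]
    ring
  have hn1 : (0 : ℝ) < (n - 1) / 2 := by linarith
  have hsq : ∀ k : ℕ, 0 ≤ (c k - c (k + 2)) ^ 2 / (2 * (k : ℝ) + n + 1) := fun k => by positivity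
  have hle : ∀ j K : ℕ, j < K → 1 / 2 * c 1 ^ 2
      + (n - 1) / 2 * ((c j - c (j + 2)) ^ 2 / (2 * (j : ℝ) + n + 1)) ≤ Q K := by
    intro j K hjK
    have := Finset.single_le_sum (f := fun k : ℕ => (c k - c (k + 2)) ^ 2 / (2 * (k : ℝ) + n + 1))
      (fun k _ => hsq k) (Finset.mem_range.mpr hjK)
    simp only [Q]
    gcongr
  have hzero : ∀ j : ℕ, 1 / 2 * c 1 ^ 2
      + (n - 1) / 2 * ((c j - c (j + 2)) ^ 2 / (2 * (j : ℝ) + n + 1)) ≤ 0 := fun j =>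
    ge_of_tendsto hQ (eventually_atTop.mpr ⟨j + 1, fun K hK => hle j K (by omega)⟩)
  have hc1 : c 1 = 0 := by
    have h1 := hzero 0
    have h3 := mul_nonneg hn1.le (hsq 0)
    have : c 1 ^ 2 = 0 := le_antisymm (by linarith) (sq_nonneg _)
    exact pow_eq_zero_iff (two_ne_zero) |>.mp this
  have hstep : ∀ j, c (j + 2) = c j := by
    intro j
    have h1 := hzero j
    have h3 := sq_nonneg (c 1)
    have h4 := hsq j
    have h5 : (c j - c (j + 2)) ^ 2 / (2 * (j : ℝ) + n + 1) = 0 := by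
      refine le_antisymm ?_ h4
      by_contra hlt
      have := mul_pos hn1 (not_le.mp hlt)
      linarith
    have h6 : (2 * (j : ℝ) + n + 1) ≠ 0 := by positivity
    have h7 := (div_eq_zero_iff.mp h5).resolve_right h6
    have h8 := pow_eq_zero_iff (two_ne_zero) |>.mp h7
    linarith
  induction k using Nat.strong_induction_on with
  | _ k ih =>
    match k, ih with
    | 0, _ => exact hc0
    | 1, _ => exact hc1
    | k + 2, ih => rw [hstep]; exact ih k (by omega)

/-- The exponential of a potential whose coefficients tend to zero has at most a mild singularity
at the poles. -/
lemma exists_exp_potential_le (hn : 2 ≤ n) {c : ℕ → ℝ} (hc : Tendsto c atTop (𝓝 0)) (a : ℝ) :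
    ∃ K : ℝ, ∀ x ∈ Ioo (-1 : ℝ) 1,
      Real.exp (n * (a + zonalPotential n c x)) ≤ K * (1 - x ^ 2) ^ (-(1 / 8) : ℝ) := by
  have hn0 : (0 : ℝ) < n := by positivity
  obtain ⟨K, hK⟩ := exists_abs_potential_le hn hc (ε := 1 / (8 * n)) (by positivity)
  refine ⟨Real.exp (n * (a + K)), fun x hx => ?_⟩
  have hy := one_sub_sq_pos hx
  obtain ⟨hS, hT⟩ := hK x hx
  have h1 : zonalPotential n c x ≤ K - 1 / (8 * n) * Real.log (1 - x ^ 2) :=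
    ((le_abs_self _).trans (norm_tsum_le_tsum_norm (f := fun k =>
      greenCoeff n (k + 1) * c (k + 1) * zonal n (k + 1) x) hS)).trans hT
  have h2 : n * (a + zonalPotential n c x)
      ≤ n * (a + K) + Real.log (1 - x ^ 2) * (-(1 / 8)) := by
    calc _ ≤ n * (a + (K - 1 / (8 * n) * Real.log (1 - x ^ 2))) := by gcongr
      _ = _ := by field_simp; ring
  refine (Real.exp_le_exp.mpr h2).trans ?_
  rw [Real.exp_add, ← Real.rpow_def_of_pos hy]

/-- The rigidity statement for functions of the first coordinate. -/
theorem zonal_rigidity (hn : 2 ≤ n) {g : ℝ → ℝ} (hg : Integrable g (zonalMeasure n))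
    (hexp : Integrable (fun x => Real.exp (n * g x)) (zonalMeasure n))
    (heq : ∀ k, zonalCoeff n (fun x => (n + 1) * (n - 1).factorial *
        (Real.exp (n * g x) / ∫ t, Real.exp (n * g t) ∂(zonalMeasure n) - 1)) k
      = (∏ j ∈ Finset.range n, ((k : ℝ) + j)) * zonalCoeff n g k) :
    ∃ a : ℝ, g =ᵐ[zonalMeasure n] fun _ => a := by
  have hprob := isProbabilityMeasure_zonalMeasure hn
  have hn' : (2 : ℝ) ≤ n := by exact_mod_cast hn
  set I := ∫ t, Real.exp (n * g t) ∂(zonalMeasure n) with hI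
  have hIpos : 0 < I := integral_exp_pos hexp
  set A : ℝ := (n + 1) * (n - 1).factorial with hA
  have hApos : 0 < A := by positivity
  have hv0 : Integrable (fun x => A * (Real.exp (n * g x) / I - 1)) (zonalMeasure n) :=
    ((hexp.div_const I).sub (integrable_const 1)).const_mul A
  set c := zonalCoeff n (fun x => A * (Real.exp (n * g x) / I - 1)) with hcdef
  have hc : Tendsto c atTop (𝓝 0) := tendsto_zonalCoeff hn hv0
  have hgU := ae_eq_const_add_potential hn hg hc heq
  set a := zonalCoeff n g 0
  set U : ℝ → ℝ := fun x => a + zonalPotential n c x with hU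
  set f : ℝ → ℝ := fun x => Real.exp (n * U x) with hf
  have hfae : (fun x => Real.exp (n * g x)) =ᵐ[zonalMeasure n] f := by
    filter_upwards [hgU] with x hx
    rw [hx]
  have hfint : Integrable f (zonalMeasure n) := hexp.congr hfae
  obtain ⟨K, hK⟩ := exists_exp_potential_le hn hc a
  -- the right-hand side of the equation, for the representative `U` of `g`
  set v : ℝ → ℝ := fun x => A * (f x / I - 1) with hvdef
  have hvae : (fun x => A * (Real.exp (n * g x) / I - 1)) =ᵐ[zonalMeasure n] v := by
    filter_upwards [hfae] with x hx
    simp only [v]; rw [← hx]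
  have hv : Integrable v (zonalMeasure n) := hv0.congr hvae
  have hcv : ∀ k, c k = zonalCoeff n v k := fun k => by
    simp only [hcdef, zonalCoeff]
    refine integral_congr_ae ?_
    filter_upwards [hvae] with x hx
    rw [hx]
  have hvK : ∀ x ∈ Ioo (-1 : ℝ) 1,
      |v x| ≤ A * (K / I + 1) * (1 - x ^ 2) ^ (-(1 / 8) : ℝ) := by
    intro x hx
    have hy := one_le_rpow_neg hx (show (0 : ℝ) ≤ 1 / 8 by norm_num)
    have hfx : 0 ≤ f x := (Real.exp_pos _).le
    simp only [v]
    rw [abs_mul, abs_of_pos hApos, mul_assoc A]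
    gcongr
    calc |f x / I - 1| ≤ |f x / I| + |1| := abs_sub _ _
      _ = f x / I + 1 := by rw [abs_one, abs_of_nonneg (by positivity)]
      _ ≤ K * (1 - x ^ 2) ^ (-(1 / 8) : ℝ) / I + (1 - x ^ 2) ^ (-(1 / 8) : ℝ) := by
        gcongr
        exact hK x hx
      _ = _ := by ring
  have hv2 : Integrable (fun x => v x ^ 2) (zonalMeasure n) := by
    refine integrable_of_abs_le_rpow hn (K := (A * (K / I + 1)) ^ 2) (s := 1 / 4)
      (hv.aestronglyMeasurable.pow 2) (by norm_num) fun x hx => ?_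
    have hy := one_sub_sq_pos hx
    rw [abs_pow]
    calc |v x| ^ 2 ≤ (A * (K / I + 1) * (1 - x ^ 2) ^ (-(1 / 8) : ℝ)) ^ 2 := by
          gcongr
          exact hvK x hx
      _ = _ := by
        rw [mul_pow, ← Real.rpow_natCast ((1 - x ^ 2) ^ (-(1 / 8) : ℝ)), ← Real.rpow_mul hy.le]
        norm_num
  have hc2 : Summable fun k : ℕ => ((k : ℝ) + 1) * c k ^ 2 := by
    simp_rw [hcv]
    exact summable_sq_zonalCoeff hn hv hv2
  have hUd : ∀ x ∈ Ioo (-1 : ℝ) 1, HasDerivAt U (zonalGradient n c x / (1 - x ^ 2)) x :=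
    fun x hx => (hasDerivAt_potential hn hc hc2 hx).const_add a
  have hfi := (gradient_mul hn hc2 hfint.aestronglyMeasurable (K := K) fun x hx => by
    rw [abs_of_pos (Real.exp_pos _)]; exact hK x hx).1
  have hfpair := integral_exp_mul_gradient hn hUd hK hfint hfi
  obtain ⟨h1i, h1s⟩ := gradient_mul hn hc2 (v := fun _ => 1) aestronglyMeasurable_const (K := 1)
    fun x hx => by
      rw [abs_one, one_mul]
      exact one_le_rpow_neg hx (by norm_num)
  have hvs := (gradient_mul hn hc2 hv.aestronglyMeasurable hvK).2
  -- the pairings of `x (1 - x²) U'` with `1`, and of `v` with the zonal polynomial of degree two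
  have hfac : ((n - 1).factorial : ℝ) ≠ 0 := by positivity
  have h1pair : ∫ x, zonalGradient n c x * (1 * x) ∂(zonalMeasure n)
      = c 2 / (n - 1).factorial / (n + 1) := by
    refine h1s.unique ?_
    have h0 : ∀ k, ∫ x, (zonal n k x - zonal n (k + 2) x) * (1 * x) ∂(zonalMeasure n)
        = if k = 1 then 1 / ((n : ℝ) + 1) else 0 := by
      intro k
      have h1 : ∀ x, (zonal n k x - zonal n (k + 2) x) * (1 * x)
          = zonal n 1 x * zonal n k x - zonal n 1 x * zonal n (k + 2) x := by
        intro x; rw [zonal_one]; ring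
      simp_rw [h1]
      rw [integral_sub (integrable_zonal_mul hn _ _) (integrable_zonal_mul hn _ _),
        integral_zonal_mul_of_ne hn (show 1 ≠ k + 2 by omega), sub_zero]
      split_ifs with hk
      · subst hk
        have h3 := zonalNormSq_succ hn 0
        rw [zonalNormSq_zero hn] at h3
        rw [← zonalNormSq, eq_div_iff (by positivity)]
        have h4 : ((n : ℝ) - 1) ≠ 0 := by intro h; linarith
        apply mul_left_cancel₀ h4
        push_cast at h3; linear_combination h3
      · exact integral_zonal_mul_of_ne hn (Ne.symm hk)
    simp_rw [h0]
    have := hasSum_single (f := fun k : ℕ => c (k + 1) / ((n - 1).factorial : ℝ) *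
      if k = 1 then 1 / ((n : ℝ) + 1) else 0) 1 fun k hk => by simp [hk]
    convert! this using 1
    rw [if_pos rfl]; ring
  have hR2 : ∫ x, zonal n 2 x ∂(zonalMeasure n) = 0 := by
    simpa using integral_zonal_mul_of_ne hn (show 0 ≠ 2 by omega)
  have hc2f : c 2 = A / I * zonalCoeff n f 2 := by
    rw [hcv]
    have h1 : ∀ x, v x * zonal n 2 x = A / I * (f x * zonal n 2 x) - A * zonal n 2 x := by
      intro x; simp only [v]; ring
    simp only [zonalCoeff]
    simp_rw [h1]
    rw [integral_sub ((integrable_mul_zonal hn hfint 2).const_mul _)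
      ((integrable_of_continuous hn (continuous_zonal n 2)).const_mul _), integral_const_mul,
      integral_const_mul, hR2, mul_zero, sub_zero]
  -- this is where the value of `α` enters: the two pairings cancel exactly
  have hvzero : ∫ x, zonalGradient n c x * (v x * x) ∂(zonalMeasure n) = 0 := by
    have h1 : ∀ x, zonalGradient n c x * (v x * x)
        = A / I * (zonalGradient n c x * (f x * x)) - A * (zonalGradient n c x * (1 * x)) := by
      intro x; simp only [v]; ring
    simp_rw [h1]
    rw [integral_sub (hfi.const_mul _) (h1i.const_mul _), integral_const_mul, integral_const_mul,
      hfpair, h1pair, ← hc2f, hA]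
    field_simp
    ring
  have hc0 : c 0 = 0 := by
    have := heq 0
    rw [this, Finset.prod_eq_zero (i := 0) (by simp; omega) (by simp), zero_mul]
  have hczero : ∀ k, c k = 0 := by
    refine coeff_eq_zero_of_pairing hn hc0 hc ?_
    rw [hvzero] at hvs
    have := hvs.mul_left ((n - 1).factorial : ℝ)
    rw [mul_zero] at this
    refine this.congr_fun fun k => ?_
    rw [integral_mul_zonal hn hv, ← hcv, ← hcv, ← hcv]
    field_simp
  refine ⟨a, hgU.trans (Eventually.of_forall fun x => ?_)⟩
  simp [hU, zonalPotential, hczero]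

end PaneitzSphere

theorem theorem1p1 (n : ℕ) (hn : 2 ≤ n) (α : ℝ) (hα : α = 1 / ((n : ℝ) + 1))
    (u : PaneitzSphere.Sph n → ℝ) (hsol : PaneitzSphere.IsSolution n α u)
    (hax : PaneitzSphere.IsAxiallySymmetric u) :
    ∃ c : ℝ, ∀ᵐ ξ ∂(PaneitzSphere.sphMeasure n), u ξ = c := by
  open PaneitzSphere in
  obtain ⟨⟨hu2, _⟩, huexp, v, hv, hP, heq⟩ := hsol
  obtain ⟨g, hgm, hug⟩ := hax
  have hmap := map_coord_sphMeasure hn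
  have hmeas := (measurable_coord (n := n)).aemeasurable (μ := sphMeasure n)
  have htransfer : ∀ h : ℝ → ℝ, Measurable h →
      ∫ ξ, h ((ξ : EuclideanSpace ℝ (Fin (n + 1))) 0) ∂(sphMeasure n)
        = ∫ x, h x ∂(zonalMeasure n) := by
    intro h hh
    rw [← hmap, integral_map hmeas hh.aestronglyMeasurable]
  have hint : ∀ h : ℝ → ℝ, Measurable h → ∀ w : Sph n → ℝ, Integrable w (sphMeasure n) →
      (w =ᵐ[sphMeasure n] fun ξ => h ((ξ : EuclideanSpace ℝ (Fin (n + 1))) 0)) →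
      Integrable h (zonalMeasure n) := by
    intro h hh w hw hwh
    rw [← hmap]
    exact (integrable_map_measure hh.aestronglyMeasurable hmeas).mpr (hw.congr hwh)
  have hem : Measurable fun x => Real.exp (n * g x) := by fun_prop
  have huge : (fun ξ => Real.exp (n * u ξ)) =ᵐ[sphMeasure n]
      fun ξ => Real.exp (n * g ((ξ : EuclideanSpace ℝ (Fin (n + 1))) 0)) := by
    filter_upwards [hug] with ξ hξ
    rw [hξ]
  have hI : ∫ η, Real.exp (n * u η) ∂(sphMeasure n) = ∫ x, Real.exp (n * g x) ∂(zonalMeasure n) := by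
    rw [integral_congr_ae huge, htransfer _ hem]
  have hgi := hint g hgm u (hu2.integrable (by norm_num)) hug
  have hei := hint _ hem _ huexp huge
  obtain ⟨a, ha⟩ := zonal_rigidity hn hgi hei fun k => by
    have hk := hP _ _ (isEigenfunction_zonal hn k)
    rw [paneitzSymbol_eigenvalue hn] at hk
    have hcm : Measurable (zonal n k) := (continuous_zonal n k).measurable
    have hl : ∫ ξ, v ξ * zonal n k ((ξ : EuclideanSpace ℝ (Fin (n + 1))) 0) ∂(sphMeasure n)
        = zonalCoeff n (fun x => (n + 1) * (n - 1).factorial *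
          (Real.exp (n * g x) / ∫ t, Real.exp (n * g t) ∂(zonalMeasure n) - 1)) k := by
      rw [zonalCoeff, ← htransfer _ (by fun_prop)]
      refine integral_congr_ae ?_
      filter_upwards [heq, huge] with ξ h1 h2
      rw [hI, h2, hα] at h1
      rw [show v ξ = (n + 1) * (n - 1).factorial *
        (Real.exp (n * g ((ξ : EuclideanSpace ℝ (Fin (n + 1))) 0))
          / ∫ t, Real.exp (n * g t) ∂(zonalMeasure n) - 1) by
        have h3 : ((n : ℝ) + 1) * (1 / (n + 1) * v ξ) = v ξ := by field_simp
        linear_combination (n + 1 : ℝ) * h1 - h3]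
    have hr : ∫ ξ, u ξ * zonal n k ((ξ : EuclideanSpace ℝ (Fin (n + 1))) 0) ∂(sphMeasure n)
        = zonalCoeff n g k := by
      rw [zonalCoeff, ← htransfer _ (by fun_prop)]
      refine integral_congr_ae ?_
      filter_upwards [hug] with ξ hξ
      rw [hξ]
    rw [← hl, ← hr]
    exact hk
  refine ⟨a, ?_⟩
  rw [← hmap] at ha
  filter_upwards [hug, ae_of_ae_map hmeas ha] with ξ h1 h2
  rw [h1, h2]
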